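/- Let $(M,d)$ be a compact metric space and let $X=\{X^t\}_{t\in\mathbb R}$ be a continuous flow on $M$ without fixed points (no orbit is a single point). For $I\subset\mathbb R$ and $A\subset M$ write $X^I(A)=\{X^t(a): t\in I,\ a\in A\}$, and $X^I(x)=X^I(\{x\})$. **$N$-expansive flows.** For $A\subset M$ let $\mathcal H(A)$ be the set of all maps $\alpha$ from $A$ to the homeomorphisms of $\mathbb R$ fixing $0$ such that $\alpha(x_\alpha)=\mathrm{id}$ for some $x_\alpha\in A$ and $a\mapsto\alpha(a)(t)$ is continuous on $A$ for every $t\in\mathbb R$. For an integer $N\ge 1$ the flow is $N$-expansive if for every $\epsilon>0$ there is $\delta>0$ such that, whenever $A\subset M$ and $\alpha\in\mathcal H(A)$ satisfy $\operatorname{diam}\{X^{\alpha(a)(t)}(a):a\in A\}<\delta$ for all $t\in\mathbb R$, there is $B\subset A$ with at most $N$ points such that $A\subset X^{(-\epsilon,\epsilon)}(B)$. **Adequate pairs.** A cross-section of time $\epsilon>0$ is a closed set $S\subset M$ with $S\cap X^{(-\epsilon,\epsilon)}(x)=\{x\}$ for all $x\in S$; put $S^*=\operatorname{int}(X^{(-\epsilon,\epsilon)}(S))\cap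 S$. A pair $(\mathcal S,\mathcal T)$ of finite families $\mathcal S=\{S_1,\dots,S_k\}$, $\mathcal T=\{T_1,\dots,T_k\}$ of cross-sections of time $\epsilon$ and diameter at most $\delta$ is $\delta$-adequate (with time $\epsilon$) if $T_i\subset S_i^*$ for all $i$ and $$M=\bigcup_{i} X^{[0,\epsilon]}(T_i)=\bigcup_{i} X^{[-\epsilon,0]}(T_i)=\bigcup_{i} X^{[0,\epsilon]}(S_i)=\bigcup_{i} X^{[-\epsilon,0]}(S_i).$$ Let $\theta$ be the supremum of all $r>0$ such that $X^{(0,r)}(x)\cap\bigcup_i S_i=\emptyset$ for all $x\in\bigcup_i S_i$, and let $\rho>0$ satisfy $5\rho<\epsilon$ and $2\rho<\theta$. On $X^{(-\rho,\rho)}(S_l)$ the projection $P^l_\rho$ sends $z$ to the point $X^r(z)\in S_l$ with $|r|<\rho$. Let $\phi:\bigcup_iT_i\to\bigcup_iT_i$ be the first-return map, $\phi(x)=X^{t}(x)$ with $t>0$ the smallest positive time for which $X^t(x)\in\bigcup_iT_i$. **Stable and unstable sets.** For $x\in T_i$ and $y\in S_i$ put $y_0=y$ and, for $j\ge 1$ and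 as long as this is defined, $y_j=P^l_\rho(X^t(y_{j-1}))$, where $t>0$ is the smallest positive time with $\phi^j(x)=X^t(\phi^{j-1}(x))$ and $\phi^j(x)\in T_l$; define $y_j$ for $j<0$ in the same way with the reversed flow. For $\eta>0$ let $W^s_\eta(x)$ (respectively $W^u_\eta(x)$) be the set of all $y\in S_i$ such that $y_j$ is defined and $d(\phi^j(x),y_j)<\eta$ for all $j\ge 0$ (respectively all $j\le 0$). **Theorem.** For $N\ge 1$ and $\epsilon,\delta>0$, let $(*)_{N,\epsilon,\delta}$ be the statement: for every $\delta$-adequate pair $(\mathcal S,\mathcal T)$ with time $\epsilon$ and every $\rho$ as above, there is $\eta>0$ such that $$\#\big(W^s_\eta(x)\cap W^u_\eta(x)\big)\le N\quad\text{for all } x\in\bigcup_{i}T_i .$$ If $X$ is $N$-expansive, then $(*)_{N,\epsilon,\delta}$ holds for all $\epsilon,\delta>0$. Moreover, there is $\epsilon_1>0$, depending only on the flow, such that for all $N\ge1$, $0<\epsilon\le\epsilon_1$ and $\delta>0$: $X$ is $N$-expansive if and only if $(*)_{N,\epsilon,\delta}$ holds. -/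

import Mathlib

open Set

namespace FlowSections

variable {M : Type*} [MetricSpace M]

/-- The flow has no fixed points: no orbit is reduced to one point. -/
def FixedPointFree (X : Flow ℝ M) : Prop := ∀ x : M, ∃ t : ℝ, X t x ≠ x

/-- `X^I(A)`, the set of all `X^t(a)` with `t ∈ I` and `a ∈ A`. -/
def sweep (X : Flow ℝ M) (I : Set ℝ) (A : Set M) : Set M :=
  {z | ∃ t ∈ I, ∃ a ∈ A, X t a = z}

/-! ### `N`-expansive flows -/

/-- Membership of `α` in the class `ℋ(A)`: a family of homeomorphisms of the line fixing the
origin, indexed by `A`, one of which is the identity, and such that `a ↦ α(a)(t)` is continuous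
on `A` for each `t`. -/
structure IsReparametrization (A : Set M) (α : A → ℝ ≃ₜ ℝ) : Prop where
  map_zero : ∀ a : A, α a 0 = 0
  exists_id : ∃ a : A, α a = Homeomorph.refl ℝ
  continuous_eval : ∀ t : ℝ, Continuous fun a : A => α a t

/-- The set of all `X^{α(a)(t)}(a)` with `a ∈ A`. -/
def reparamImage (X : Flow ℝ M) (A : Set M) (α : A → ℝ ≃ₜ ℝ) (t : ℝ) : Set M :=
  Set.range fun a : A => X (α a t) (a : M)

/-- `N`-expansive flows (on a compact, hence bounded, space). -/
def IsNExpansive (X : Flow ℝ M) (N : ℕ) : Prop :=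
  ∀ ε : ℝ, 0 < ε → ∃ δ : ℝ, 0 < δ ∧
    ∀ (A : Set M) (α : A → ℝ ≃ₜ ℝ), IsReparametrization A α →
      (∀ t : ℝ, Metric.diam (reparamImage X A α t) < δ) →
      ∃ B : Set M, B ⊆ A ∧ B.encard ≤ N ∧ A ⊆ sweep X (Ioo (-ε) ε) B

/-! ### Adequate pairs of families of local cross-sections -/

/-- `S` is a (local) cross-section of time `ε`. -/
structure IsCrossSection (X : Flow ℝ M) (ε : ℝ) (S : Set M) : Prop where
  isClosed : IsClosed S
  inter_eq : ∀ x ∈ S, S ∩ sweep X (Ioo (-ε) ε) {x} = {x}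

/-- The interior `S^*` of a cross-section of time `ε`. -/
def sectionInterior (X : Flow ℝ M) (ε : ℝ) (S : Set M) : Set M :=
  interior (sweep X (Ioo (-ε) ε) S) ∩ S

/-- The pair `(S, T)` of finite families of cross-sections of time `ε` is `δ`-adequate. -/
structure IsAdequate (X : Flow ℝ M) (ε δ : ℝ) {k : ℕ} (S T : Fin k → Set M) : Prop where
  section_S : ∀ i, IsCrossSection X ε (S i)
  section_T : ∀ i, IsCrossSection X ε (T i)
  diam_S : ∀ i, Metric.diam (S i) ≤ δ
  diam_T : ∀ i, Metric.diam (T i) ≤ δ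
  subset_interior : ∀ i, T i ⊆ sectionInterior X ε (S i)
  cover_T_pos : (⋃ i, sweep X (Icc 0 ε) (T i)) = univ
  cover_T_neg : (⋃ i, sweep X (Icc (-ε) 0) (T i)) = univ
  cover_S_pos : (⋃ i, sweep X (Icc 0 ε) (S i)) = univ
  cover_S_neg : (⋃ i, sweep X (Icc (-ε) 0) (S i)) = univ

/-- The number `θ`: the supremum of all `r > 0` such that no orbit starting in `⋃ S_i` meets
`⋃ S_i` at a time in `(0, r)`. -/
noncomputable def separation (X : Flow ℝ M) {k : ℕ} (S : Fin k → Set M) : ℝ :=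
  sSup {r : ℝ | 0 < r ∧ ∀ x ∈ ⋃ i, S i, sweep X (Ioo 0 r) {x} ∩ (⋃ i, S i) = ∅}

/-! ### First-return map, stable and unstable sets -/

/-- The first positive time at which the orbit of `x` meets `C`. For an adequate pair with `θ > 0`
and `C = ⋃ T_i`, `x ∈ C`, the set below is nonempty and the infimum is attained and positive. -/
noncomputable def returnTime (X : Flow ℝ M) (C : Set M) (x : M) : ℝ :=
  sInf {t : ℝ | 0 < t ∧ X t x ∈ C}

/-- The first-return map `φ` to `C`. For the reversed flow this is the inverse of `φ` on `C`. -/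
noncomputable def returnMap (X : Flow ℝ M) (C : Set M) (x : M) : M :=
  X (returnTime X C x) x

/-- `w = P_ρ(z)` for the projection along the flow, in time less than `ρ`, onto the
section `S`; in particular `z` belongs to `X^{(-ρ,ρ)}(S)`. -/
def IsProjection (X : Flow ℝ M) (ρ : ℝ) (S : Set M) (z w : M) : Prop :=
  w ∈ S ∧ ∃ r : ℝ, |r| < ρ ∧ X r z = w

/-- `u` is the sequence `y_0 = y, y_1, y_2, …` obtained from `y` by following the returns of `x`:
`y_{j+1}` is the projection of `X^t(y_j)` onto `S_l`, where `t` is the return time of `φ^j(x)` and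
`φ^{j+1}(x) ∈ T_l`. -/
structure IsFollowing (X : Flow ℝ M) {k : ℕ} (S T : Fin k → Set M) (ρ : ℝ) (x y : M)
    (u : ℕ → M) : Prop where
  zero : u 0 = y
  succ : ∀ j : ℕ, ∃ l : Fin k, (returnMap X (⋃ i, T i))^[j + 1] x ∈ T l ∧
    IsProjection X ρ (S l)
      (X (returnTime X (⋃ i, T i) ((returnMap X (⋃ i, T i))^[j] x)) (u j)) (u (j + 1))

/-- The `η`-stable set `W^s_η(x)` of a point `x ∈ T_i`. -/
def stableSet (X : Flow ℝ M) {k : ℕ} (S T : Fin k → Set M) (ρ η : ℝ) (i : Fin k) (x : M) :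
    Set M :=
  {y | y ∈ S i ∧ ∃ u : ℕ → M, IsFollowing X S T ρ x y u ∧
    ∀ j : ℕ, dist ((returnMap X (⋃ i, T i))^[j] x) (u j) < η}

/-- The `η`-unstable set `W^u_η(x)` of a point `x ∈ T_i`: the same with negative indices, that is,
for the reversed flow `t ↦ X^{-t}`. -/
def unstableSet (X : Flow ℝ M) {k : ℕ} (S T : Fin k → Set M) (ρ η : ℝ) (i : Fin k) (x : M) :
    Set M :=
  stableSet X.reverse S T ρ η i x

/-- For every `δ`-adequate pair of families of cross-sections of time `ε` (and every projection
time `ρ` allowed for it) there is `η > 0` such that `W^s_η(x) ∩ W^u_η(x)` has at most `N` points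
for all `x ∈ ⋃ T_i`. -/
def SectionBound (X : Flow ℝ M) (N : ℕ) (ε δ : ℝ) : Prop :=
  ∀ (k : ℕ) (S T : Fin k → Set M), IsAdequate X ε δ S T →
    ∀ ρ : ℝ, 0 < ρ → 5 * ρ < ε → 2 * ρ < separation X S →
      ∃ η : ℝ, 0 < η ∧ ∀ (i : Fin k), ∀ x ∈ T i,
        (stableSet X S T ρ η i x ∩ unstableSet X S T ρ η i x).encard ≤ N

end FlowSections

/-! For small `η`, a point `y` of both the stable and the unstable set of `x` is a section point
whose whole orbit, after a time change, stays close to the orbit of `x`. The theorem rests on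
passing between these two descriptions, and on the existence of good sections.

Expansive implies bounded: orbits do not return to the sections before some time `r > ρ`, so a small
`η` forces every projection time to be small (`uniform_projection_time`). Stretching each return
interval linearly by this correction gives a time change on each half-line (`exists_interpolation`,
`exists_shadowing`). If an intersection had `N + 1` points, expansiveness would move them along the
flow, in time less than `r`, onto at most `N` section points. Such moves between section points are
trivial, a contradiction.

Bounded implies expansive: the bound is vacuous for a pair with `θ = 0`, so a pair with `θ > 0` must
be built. Level sets of a function increasing along the flow (`exists_locally_increasing`) are local
sections; cutting them up and sliding the pieces along the flow makes them disjoint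
(`exists_extension`, `exists_adequate`). Given orbits kept close by time changes, flow the reference
orbit to some `T i` and project the others to `S i`. Time changes drift little over one return
(`uniform_drift`), so the landing points lie in one intersection (`exists_mem_stableSet`), and there
are at most `N` of them. Points with the same landing point lie on one orbit, a short time apart. -/

namespace FlowSections

open Topology Filter

variable {M : Type*} [MetricSpace M]

/-! ### Transverse sets and thick subsets -/

/-- No orbit meets `S` twice within time less than `τ`. -/
def IsTransverse (X : Flow ℝ M) (τ : ℝ) (S : Set M) : Prop :=
  ∀ p ∈ S, ∀ t, |t| < τ → X t p ∈ S → t = 0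

/-- `T` lies in `S`, and flowing `S` for arbitrarily small times covers neighbourhoods of the
points of `T`. -/
structure IsThick (X : Flow ℝ M) (S T : Set M) : Prop where
  subset : T ⊆ S
  mem_interior : ∀ γ : ℝ, 0 < γ → T ⊆ interior (sweep X (Ioo (-γ) γ) S)

/-- A closed set transverse for time `τ` together with a closed thick subset. -/
structure IsSectionPair (X : Flow ℝ M) (τ : ℝ) (S T : Set M) : Prop where
  isClosed_left : IsClosed S
  isClosed_right : IsClosed T
  transverse : IsTransverse X τ S
  thick : IsThick X S T

theorem sweep_mono {X : Flow ℝ M} {I J : Set ℝ} {A B : Set M} (h : I ⊆ J) (h' : A ⊆ B) :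
    sweep X I A ⊆ sweep X J B := fun _ ⟨t, ht, a, ha, e⟩ => ⟨t, h ht, a, h' ha, e⟩

theorem IsTransverse.mono {X : Flow ℝ M} {τ : ℝ} {S S' : Set M} (h : IsTransverse X τ S)
    (hS : S' ⊆ S) : IsTransverse X τ S' := fun p hp t ht hm => h p (hS hp) t ht (hS hm)

theorem IsTransverse.isCrossSection {X : Flow ℝ M} {τ ε : ℝ} {S : Set M}
    (h : IsTransverse X τ S) (hε : 0 < ε) (hετ : ε ≤ τ) (hS : IsClosed S) :
    IsCrossSection X ε S := by
  refine ⟨hS, fun x hx => Subset.antisymm ?_ ?_⟩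
  · rintro _ ⟨hz, t, ht, _, rfl, rfl⟩
    rw [h _ hx t ((abs_lt.2 ht).trans_le hετ) hz]
    simp
  · rintro _ rfl
    exact ⟨hx, 0, by simp [hε], _, rfl, by simp⟩

variable [CompactSpace M]

/-! ### Uniform estimates for flows on compact spaces -/

theorem flow_neg_flow {α : Type*} [TopologicalSpace α] (X : Flow ℝ α) (t : ℝ) (x : α) :
    X (-t) (X t x) = x := by
  rw [← X.map_add, neg_add_cancel, X.map_zero_apply]

theorem flow_flow_neg {α : Type*} [TopologicalSpace α] (X : Flow ℝ α) (t : ℝ) (x : α) :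
    X t (X (-t) x) = x := by
  rw [← X.map_add, add_neg_cancel, X.map_zero_apply]

theorem uniform_dist_flow (X : Flow ℝ M) (L : ℝ) {η : ℝ} (hη : 0 < η) :
    ∃ δ > 0, ∀ p q : M, dist p q < δ → ∀ t, |t| ≤ L → dist (X t p) (X t q) < η := by
  have hK : IsCompact (Icc (-L) L ×ˢ (univ : Set M)) := isCompact_Icc.prod isCompact_univ
  have hu := hK.uniformContinuousOn_of_continuous
    (f := fun z : ℝ × M => X z.1 z.2) (by fun_prop)
  rw [Metric.uniformContinuousOn_iff] at hu
  obtain ⟨δ, hδ, h⟩ := hu η hη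
  refine ⟨δ, hδ, fun p q hpq t ht => ?_⟩
  have ht' : t ∈ Icc (-L) L := abs_le.1 ht
  exact h (t, p) ⟨ht', mem_univ _⟩ (t, q) ⟨ht', mem_univ _⟩ (by simpa [Prod.dist_eq, hδ] using hpq)

theorem uniform_dist_flow_self (X : Flow ℝ M) {η : ℝ} (hη : 0 < η) :
    ∃ r > 0, ∀ p : M, ∀ t, |t| < r → dist (X t p) p < η := by
  have hK : IsCompact (Icc (-1 : ℝ) 1 ×ˢ (univ : Set M)) := isCompact_Icc.prod isCompact_univ
  have hu := hK.uniformContinuousOn_of_continuous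
    (f := fun z : ℝ × M => X z.1 z.2) (by fun_prop)
  rw [Metric.uniformContinuousOn_iff] at hu
  obtain ⟨δ, hδ, h⟩ := hu η hη
  refine ⟨min δ 1, lt_min hδ one_pos, fun p t ht => ?_⟩
  have h1 := lt_min_iff.1 ht
  have := h (t, p) ⟨abs_le.1 h1.2.le, mem_univ _⟩ (0, p) ⟨by simp, mem_univ _⟩
    (by simpa [Prod.dist_eq, Real.dist_eq, hδ] using h1.1)
  simpa using this

/-! ### A local function increasing along the flow -/

/-- Averaging the distance to `x` over a time window of length `a` gives a function whose derivative
along the flow is `dist x (X a y) - dist x y`. This is positive near `x`, because `X a x` is away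
from `x`. -/
theorem exists_locally_increasing (X : Flow ℝ M) {x : M} {a : ℝ} (hx : X a x ≠ x) :
    ∃ g : M → ℝ, Continuous g ∧ ∃ R > 0, ∃ σ > 0, ∀ y, dist y x ≤ R →
      StrictMonoOn (fun t => g (X t y)) (Icc (-σ) σ) := by
  set c := dist (X a x) x with hc
  have hc0 : 0 < c := dist_pos.2 hx
  obtain ⟨δ₁, hδ₁, h₁⟩ := uniform_dist_flow X |a| (η := c / 4) (by positivity)
  obtain ⟨σ, hσ, h₂⟩ := uniform_dist_flow_self X (η := min δ₁ (c / 4) / 2) (by positivity)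
  let g : M → ℝ := fun y => ∫ s in (0 : ℝ)..a, dist x (X s y)
  have hg : Continuous g := by
    apply intervalIntegral.continuous_parametric_intervalIntegral_of_continuous
    · fun_prop
    · fun_prop
  refine ⟨g, hg, min δ₁ (c / 4) / 2, by positivity, σ / 2, by positivity, fun y hy => ?_⟩
  intro s hs t ht hst
  have hcont : Continuous fun u => dist x (X u y) := by fun_prop
  -- Flowing shifts the window of integration, so an increment of `g` along the orbit is the
  -- integral of the difference of the integrand at the two ends of the window.
  have hgt : ∀ t, g (X t y) = ∫ u in t..(t + a), dist x (X u y) := fun t => by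
    have := intervalIntegral.integral_comp_add_right (a := 0) (b := a)
      (fun u => dist x (X u y)) t
    simp only [X.map_add] at this
    rw [zero_add, add_comm a t] at this
    exact this
  have key : g (X t y) - g (X s y) =
      ∫ u in s..t, (dist x (X (u + a) y) - dist x (X u y)) := by
    rw [hgt, hgt, intervalIntegral.integral_interval_sub_interval_comm
      (hcont.intervalIntegrable _ _) (hcont.intervalIntegrable _ _)
      (hcont.intervalIntegrable _ _), intervalIntegral.integral_sub
      ((by fun_prop : Continuous fun u => dist x (X (u + a) y)).intervalIntegrable _ _)
      (hcont.intervalIntegrable _ _),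
      intervalIntegral.integral_comp_add_right (fun u => dist x (X u y)) a,
      intervalIntegral.integral_symm s t, intervalIntegral.integral_symm (s + a) (t + a)]
    ring
  have hpos : 0 < ∫ u in s..t, (dist x (X (u + a) y) - dist x (X u y)) := by
    apply intervalIntegral.intervalIntegral_pos_of_pos_on _ _ hst
    · exact (by fun_prop : Continuous fun u =>
        dist x (X (u + a) y) - dist x (X u y)).intervalIntegrable _ _
    · intro u hu
      have hu' : |u| < σ := by
        rw [abs_lt]; constructor <;> linarith [hs.1, ht.2, hu.1, hu.2]
      have e1 := h₂ y u hu'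
      have e2 : dist (X u y) x < min δ₁ (c / 4) := by
        linarith [dist_triangle (X u y) y x]
      have e3 := h₁ _ _ (e2.trans_le (min_le_left _ _)) a le_rfl
      rw [← X.map_add, add_comm a u] at e3
      have e4 := e2.trans_le (min_le_right _ _)
      have e5 := dist_triangle_left (X a x) x (X (u + a) y)
      rw [dist_comm x (X (u + a) y), dist_comm x (X u y)]
      linarith
  have := key ▸ hpos
  show g (X s y) < g (X t y)
  linarith

/-- A function strictly increasing along short orbit segments excludes short periods near each
point; compactness makes the bound uniform. -/
theorem exists_min_period (X : Flow ℝ M) (hX : FixedPointFree X) :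
    ∃ τ > 0, ∀ x : M, ∀ t, |t| < τ → X t x = x → t = 0 := by
  have key : ∀ K : Set M, IsCompact K → ∃ τ > 0, ∀ x ∈ K, ∀ t, |t| < τ → X t x = x → t = 0 := by
    intro K hK
    refine hK.induction_on ⟨1, one_pos, by simp⟩ ?_ ?_ ?_
    · rintro s t hst ⟨τ, h0, h⟩
      exact ⟨τ, h0, fun x hx => h x (hst hx)⟩
    · rintro s t ⟨τ, h0, h⟩ ⟨τ', h0', h'⟩
      refine ⟨min τ τ', lt_min h0 h0', fun x hx u hu => ?_⟩
      rcases hx with hx | hx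
      · exact h x hx u (lt_min_iff.1 hu).1
      · exact h' x hx u (lt_min_iff.1 hu).2
    · intro x hx
      obtain ⟨a, ha⟩ := hX x
      obtain ⟨g, -, R, hR, σ, hσ, h⟩ := exists_locally_increasing X ha
      refine ⟨Metric.closedBall x R, mem_nhdsWithin_of_mem_nhds (Metric.closedBall_mem_nhds x hR),
        σ, hσ, fun y hy t ht hty => ?_⟩
      have hmem : t ∈ Icc (-σ) σ := abs_le.1 ht.le
      refine (h y hy).injOn hmem (by simp [hσ.le]) ?_
      simp [hty]
  obtain ⟨τ, h0, h⟩ := key univ isCompact_univ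
  exact ⟨τ, h0, fun x => h x (mem_univ x)⟩

/-! ### Local sections -/

/-- Level sets of a function increasing along the flow absorb nearby points in short time. -/
theorem mem_interior_sweep_level {X : Flow ℝ M} {g : M → ℝ} (hg : Continuous g) {x p : M}
    {R σ c : ℝ} (hσ : 0 < σ)
    (h : StrictMonoOn (fun t => g (X t p)) (Icc (-σ) σ)) (hp : dist p x < R) (hpc : g p = c)
    {γ : ℝ} (hγ : 0 < γ) :
    p ∈ interior (sweep X (Ioo (-γ) γ) {y | dist y x ≤ R ∧ g y = c}) := by
  obtain ⟨r, hr, hr'⟩ := uniform_dist_flow_self X (η := (R - dist p x) / 2) (by linarith)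
  set γ' := min (min (γ / 2) (r / 2)) σ with hγ'
  have h0 : 0 < γ' := by positivity
  have hle1 : γ' ≤ γ / 2 := (min_le_left _ _).trans (min_le_left _ _)
  have hle2 : γ' ≤ r / 2 := (min_le_left _ _).trans (min_le_right _ _)
  have hle3 : γ' ≤ σ := min_le_right _ _
  have hup : c < g (X γ' p) := by
    have := h (a := 0) (b := γ') (by simp [hσ.le]) ⟨by linarith, hle3⟩ h0
    simpa [hpc] using this
  have hdn : g (X (-γ') p) < c := by
    have := h (a := -γ') (b := 0) ⟨by linarith, by linarith⟩ (by simp [hσ.le]) (by linarith)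
    simpa [hpc] using this
  rw [mem_interior_iff_mem_nhds]
  have e1 : ∀ᶠ z in 𝓝 p, c < g (X γ' z) :=
    (by fun_prop : Continuous fun z => g (X γ' z)).continuousAt.eventually_const_lt hup
  have e2 : ∀ᶠ z in 𝓝 p, g (X (-γ') z) < c :=
    (by fun_prop : Continuous fun z => g (X (-γ') z)).continuousAt.eventually_lt_const hdn
  have e3 : ∀ᶠ z in 𝓝 p, dist z p < (R - dist p x) / 2 :=
    Metric.ball_mem_nhds _ (by linarith)
  filter_upwards [e1, e2, e3] with z z1 z2 z3
  have hc : Continuous fun t => g (X t z) := by fun_prop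
  obtain ⟨t, ht, htc⟩ := intermediate_value_Icc (by linarith : -γ' ≤ γ') hc.continuousOn
    ⟨z2.le, z1.le⟩
  have hta : |t| ≤ γ' := abs_le.2 ht
  refine ⟨-t, ⟨by linarith [ht.2], by linarith [ht.1]⟩, X t z, ⟨?_, htc⟩, flow_neg_flow X t z⟩
  have := hr' z t (by linarith)
  linarith [dist_triangle (X t z) z p, dist_triangle (X t z) p x]

/-- Through each point of a flow without periods less than `2τ` passes a section pair. -/
theorem exists_local_section (X : Flow ℝ M) (hX : FixedPointFree X) {τ : ℝ}
    (hτ : ∀ x : M, ∀ t, |t| ≤ τ → X t x = x → t = 0) (x : M) :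
    ∃ S T : Set M, IsSectionPair X τ S T ∧
      ∀ γ > 0, x ∈ interior (sweep X (Ioo (-γ) γ) T) := by
  obtain ⟨a, ha⟩ := hX x
  obtain ⟨g, hg, R₀, hR₀, σ, hσ, h⟩ := exists_locally_increasing X ha
  -- Monotonicity of `g` excludes a second hit in times up to `σ`. For `σ ≤ |t| ≤ τ` the point `x`
  -- is displaced by at least `m`, so points within `m / 3` of `x` leave the small ball.
  obtain ⟨m, hm, hmin⟩ := (isCompact_Icc.inter_right
    (isClosed_le continuous_const continuous_abs : IsClosed {t : ℝ | σ ≤ |t|})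
    |>.exists_forall_le' (a := (0 : ℝ)) (s := Icc (-τ) τ ∩ {t : ℝ | σ ≤ |t|})
    (f := fun t => dist (X t x) x) (by fun_prop) (by
      rintro t ⟨ht, hσt⟩
      refine dist_pos.2 fun e => ?_
      have := hτ x t (abs_le.2 ht) e
      subst this
      simp at hσt
      linarith))
  obtain ⟨δ, hδ, hu⟩ := uniform_dist_flow X τ (η := m / 3) (by positivity)
  set R := min R₀ (min (δ / 2) (m / 3)) with hR
  have hRpos : 0 < R := by positivity
  have hR1 : R ≤ R₀ := min_le_left _ _
  have hR2 : R ≤ δ / 2 := (min_le_right _ _).trans (min_le_left _ _)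
  have hR3 : R ≤ m / 3 := (min_le_right _ _).trans (min_le_right _ _)
  have hcl : ∀ r, IsClosed {y | dist y x ≤ r ∧ g y = g x} := fun r =>
    (isClosed_le (by fun_prop : Continuous fun y : M => dist y x) continuous_const).inter
      (isClosed_eq hg continuous_const)
  refine ⟨{y | dist y x ≤ R ∧ g y = g x}, {y | dist y x ≤ R / 2 ∧ g y = g x},
    ⟨hcl _, hcl _, ?_, ?_, ?_⟩, ?_⟩
  · rintro p ⟨hp, hgp⟩ t ht ⟨hq, hgq⟩
    rcases lt_or_ge |t| σ with hlt | hge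
    · refine (h p (hp.trans hR1)).injOn (abs_le.1 hlt.le) (by simp [hσ.le]) ?_
      simp [hgp, hgq]
    · have h1 := hmin t ⟨abs_le.1 ht.le, hge⟩
      have h2 := hu p x (by linarith) t ht.le
      linarith [dist_triangle_left (X t x) x (X t p)]
  · rintro p ⟨hp, hgp⟩
    exact ⟨by linarith, hgp⟩
  · rintro γ hγ p ⟨hp, hgp⟩
    exact mem_interior_sweep_level hg hσ (h p (by linarith)) (by linarith) hgp hγ
  · intro γ hγ
    exact mem_interior_sweep_level hg hσ (h x (by simp [hR₀.le])) (by simpa) rfl hγ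

end FlowSections

namespace FlowSections

open Topology Filter

variable {M : Type*} [MetricSpace M]

/-! ### Restricting and translating section pairs -/

theorem sweep_image (X : Flow ℝ M) (s : ℝ) (I : Set ℝ) (A : Set M) :
    sweep X I (X s '' A) = X s '' sweep X I A := by
  ext z
  constructor
  · rintro ⟨t, ht, _, ⟨a, ha, rfl⟩, rfl⟩
    exact ⟨X t a, ⟨t, ht, a, ha, rfl⟩, by rw [← X.map_add, ← X.map_add, add_comm]⟩
  · rintro ⟨_, ⟨t, ht, a, ha, rfl⟩, rfl⟩
    exact ⟨t, ht, X s a, ⟨a, ha, rfl⟩, by rw [← X.map_add, ← X.map_add, add_comm]⟩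

theorem IsSectionPair.translate {X : Flow ℝ M} {τ : ℝ} {S T : Set M}
    (h : IsSectionPair X τ S T) (s : ℝ) : IsSectionPair X τ (X s '' S) (X s '' T) := by
  refine ⟨(X.toHomeomorph s).isClosedMap _ h.isClosed_left,
    (X.toHomeomorph s).isClosedMap _ h.isClosed_right, ?_, image_mono h.thick.subset, ?_⟩
  · rintro _ ⟨p, hp, rfl⟩ t ht ⟨q, hq, e⟩
    refine h.transverse p hp t ht ?_
    rw [← X.map_add, add_comm, X.map_add] at e
    have := (X.toHomeomorph s).injective e
    exact this ▸ hq
  · intro γ hγ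
    have := (X.toHomeomorph s).image_interior (sweep X (Ioo (-γ) γ) S)
    rw [sweep_image]
    exact (image_mono (h.thick.mem_interior γ hγ)).trans this.subset

/-- This supplies pairwise different sliding times for the pieces of one section. -/
theorem exists_injOn_of_infinite {α β : Type*} (J : Finset α) (I : α → Set β)
    (hI : ∀ a, (I a).Infinite) : ∃ s : α → β, (∀ a, s a ∈ I a) ∧ InjOn s J := by
  classical
  induction J using Finset.induction with
  | empty => exact ⟨fun a => (hI a).nonempty.some, fun a => (hI a).nonempty.some_mem, by simp⟩
  | insert a J ha ih =>
    obtain ⟨s, hs, hinj⟩ := ih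
    obtain ⟨b, hb, hb'⟩ := (hI a).exists_notMem_finset (J.image s)
    refine ⟨Function.update s a b, fun c => ?_, ?_⟩
    · by_cases hc : c = a
      · subst hc; simpa
      · simpa [hc] using hs c
    · rw [Finset.coe_insert, injOn_insert (by simpa using ha)]
      have heq : EqOn (Function.update s a b) s J := fun c hc => by
        have : c ≠ a := fun e => ha (e ▸ hc)
        simp [this]
      refine ⟨heq.injOn_iff.2 hinj, ?_⟩
      rw [heq.image_eq]
      simpa using hb'

/-- Two hits in the window are less than `2 * κ ≤ τ` apart, so there is at most one. Finiteness is
the form that survives a finite union of sections. -/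
theorem IsTransverse.finite_hits {X : Flow ℝ M} {τ κ : ℝ} {S : Set M} (h : IsTransverse X τ S)
    (hκ : 2 * κ ≤ τ) (y : M) : {s ∈ Ioo (-κ) κ | X s y ∈ S}.Finite := by
  refine Set.Subsingleton.finite ?_
  rintro s ⟨hs, hsy⟩ t ⟨ht, hty⟩
  have := h _ hsy (t - s) (by rw [abs_lt]; constructor <;> linarith [hs.1, hs.2, ht.1, ht.2])
    (by rwa [← X.map_add, sub_add_cancel])
  linarith

/-- Every point has a neighbourhood that is moved off `D` by infinitely many small times. -/
theorem exists_translates_avoiding {X : Flow ℝ M} {κ δ : ℝ} (hκ : 0 < κ) (hδ : 0 < δ) {D : Set M}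
    (hD : IsClosed D) {y : M} (hy : {s ∈ Ioo (-κ) κ | X s y ∈ D}.Finite) :
    ∃ I : Set ℝ, I.Infinite ∧ I ⊆ Ioo (-κ) κ ∧ ∃ r > 0, ∃ c : M,
      ∀ s ∈ I, ∀ p ∈ Metric.closedBall y (2 * r), X s p ∈ Metric.ball c δ ∩ Dᶜ := by
  obtain ⟨s₀, hs₀, hs₀'⟩ := (Ioo_infinite (by linarith : -κ < κ)).exists_notMem_finite hy
  have hs₁ : X s₀ y ∉ D := fun h => hs₀' ⟨hs₀, h⟩
  have hW : ∀ᶠ z : ℝ × M in 𝓝 (s₀, y), X z.1 z.2 ∈ Metric.ball (X s₀ y) δ ∩ Dᶜ := by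
    have hc : Continuous fun z : ℝ × M => X z.1 z.2 := by fun_prop
    exact hc.continuousAt.eventually
      ((Metric.isOpen_ball.inter hD.isOpen_compl).mem_nhds ⟨Metric.mem_ball_self hδ, hs₁⟩)
  rw [nhds_prod_eq] at hW
  obtain ⟨u, hu, V, hV, huV⟩ := mem_prod_iff.1 hW
  obtain ⟨r, hr, hrV⟩ := Metric.nhds_basis_closedBall.mem_iff.1 hV
  refine ⟨u ∩ Ioo (-κ) κ, infinite_of_mem_nhds s₀ (inter_mem hu (Ioo_mem_nhds hs₀.1 hs₀.2)),
    inter_subset_right, r / 2, by positivity, X s₀ y, fun s hs p hp => ?_⟩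
  exact huV (mk_mem_prod hs.1 (hrV (by rwa [mul_div_cancel₀ _ two_ne_zero] at hp)))

theorem separation_pos [Nonempty M] {X : Flow ℝ M} {k : ℕ} {S : Fin k → Set M} {ε r : ℝ}
    (hε : 0 < ε) (hr : 0 < r) (hret : ∀ p ∈ ⋃ i, S i, ∀ t ∈ Ioo 0 r, X t p ∉ ⋃ i, S i)
    (hcover : ∀ z, ∃ s ∈ Icc 0 ε, X s z ∈ ⋃ i, S i) : 0 < separation X S := by
  -- The supremum must be bounded to be meaningful: from any section point, waiting `ε` and then at
  -- most `ε` more reaches a section again, so no admissible time exceeds `3 * ε`.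
  refine hr.trans_le (le_csSup ⟨3 * ε, ?_⟩ ⟨hr, fun x hx => ?_⟩)
  · rintro q ⟨-, hq⟩
    by_contra! hlt
    obtain ⟨s, -, hp⟩ := hcover (Classical.arbitrary M)
    obtain ⟨s', hs', hp'⟩ := hcover (X ε (X s (Classical.arbitrary M)))
    have : X (s' + ε) (X s (Classical.arbitrary M)) ∈
        sweep X (Ioo 0 q) {X s (Classical.arbitrary M)} ∩ ⋃ i, S i :=
      ⟨⟨s' + ε, ⟨by linarith [hs'.1], by linarith [hs'.2]⟩, _, rfl, rfl⟩, by
        rwa [X.map_add]⟩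
    rw [hq _ hp] at this
    exact this
  · rw [← disjoint_iff_inter_eq_empty, disjoint_left]
    rintro _ ⟨t, ht, _, rfl, rfl⟩ hm
    exact hret _ hx t ht hm

variable [CompactSpace M]

/-- The section keeps twice the radius of its thick subset, so short flow segments from near the
subset still end in the cut section. -/
theorem IsSectionPair.restrict {X : Flow ℝ M} {τ : ℝ} {S T : Set M}
    (h : IsSectionPair X τ S T) (y : M) {r : ℝ} (hr : 0 < r) :
    IsSectionPair X τ (S ∩ Metric.closedBall y (2 * r)) (T ∩ Metric.closedBall y r) := by
  refine ⟨h.isClosed_left.inter Metric.isClosed_closedBall,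
    h.isClosed_right.inter Metric.isClosed_closedBall, h.transverse.mono inter_subset_left,
    inter_subset_inter h.thick.subset (Metric.closedBall_subset_closedBall (by linarith)), ?_⟩
  rintro γ hγ p ⟨hp, hpy⟩
  obtain ⟨ρ, hρ, hd⟩ := uniform_dist_flow_self X (η := r / 2) (by positivity)
  have h1 := h.thick.mem_interior (min γ ρ) (lt_min hγ hρ) hp
  rw [mem_interior_iff_mem_nhds] at h1 ⊢
  filter_upwards [h1, Metric.ball_mem_nhds p (half_pos hr)]
  rintro _ ⟨t, ht, a, ha, rfl⟩ hz
  have hta := lt_min_iff.1 (abs_lt.2 ht)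
  refine ⟨t, abs_lt.1 hta.1, a, ⟨ha, ?_⟩, rfl⟩
  have e1 := hd a t hta.2
  rw [Metric.mem_closedBall] at hpy ⊢
  rw [Metric.mem_ball] at hz
  linarith [dist_triangle_left a p (X t a), dist_triangle a p y]

/-! ### Families of disjoint section pairs -/

/-- A finite family of small section pairs with pairwise disjoint sections. -/
structure IsDisjointFamily (X : Flow ℝ M) (τ δ : ℝ) (F : Finset (Set M × Set M)) : Prop where
  pair : ∀ P ∈ F, IsSectionPair X τ P.1 P.2
  diam : ∀ P ∈ F, Metric.diam P.1 ≤ δ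
  disjoint : ∀ P ∈ F, ∀ Q ∈ F, P ≠ Q → Disjoint P.1 Q.1

/-- The new section is cut into small pieces, each slid along the flow off the old sections. The
sliding times are distinct and differ by less than `τ`, so by transversality the slid pieces do not
meet each other either. -/
theorem IsDisjointFamily.exists_extension {X : Flow ℝ M} {τ δ κ : ℝ}
    {F : Finset (Set M × Set M)} (hF : IsDisjointFamily X τ δ F) (hδ : 0 < δ) (hκ : 0 < κ)
    (hκτ : 2 * κ ≤ τ) {S T : Set M} (h : IsSectionPair X τ S T) :
    ∃ F', F ⊆ F' ∧ IsDisjointFamily X τ δ F' ∧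
      T ⊆ sweep X (Ioo (-κ) κ) (⋃ P ∈ F', P.2) := by
  classical
  set D := ⋃ P ∈ F, P.1 with hDdef
  have hD : IsClosed D := F.finite_toSet.isClosed_biUnion fun P hP => (hF.pair P hP).isClosed_left
  have hfin : ∀ y : M, {s ∈ Ioo (-κ) κ | X s y ∈ D}.Finite := fun y => by
    refine (F.finite_toSet.biUnion fun P hP =>
      (hF.pair P hP).transverse.finite_hits hκτ y).subset ?_
    rintro s ⟨hs, hsD⟩
    obtain ⟨P, hP, hm⟩ := mem_iUnion₂.1 hsD
    exact mem_iUnion₂.2 ⟨P, hP, hs, hm⟩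
  choose I hI hIκ r hr c hc using fun y : M =>
    exists_translates_avoiding hκ (half_pos hδ) hD (hfin y)
  obtain ⟨J, -, hJ⟩ := h.isClosed_right.isCompact.elim_nhds_subcover
    (fun y => Metric.ball y (r y)) (fun y _ => Metric.ball_mem_nhds y (hr y))
  obtain ⟨s, hs, hinj⟩ := exists_injOn_of_infinite J I hI
  let A : M → Set M × Set M := fun y =>
    (X (s y) '' (S ∩ Metric.closedBall y (2 * r y)), X (s y) '' (T ∩ Metric.closedBall y (r y)))
  have hA : ∀ y, IsSectionPair X τ (A y).1 (A y).2 := fun y => (h.restrict y (hr y)).translate _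
  have hAsub : ∀ y, (A y).1 ⊆ Metric.ball (c y) (δ / 2) ∩ Dᶜ := by
    rintro y _ ⟨p, hp, rfl⟩
    exact hc y _ (hs y) p hp.2
  have hFA : ∀ P ∈ F, ∀ y, Disjoint P.1 (A y).1 := fun P hP y =>
    disjoint_left.2 fun z hz hz' => (hAsub y hz').2 (mem_iUnion₂.2 ⟨P, hP, hz⟩)
  have hAA : ∀ y ∈ J, ∀ y' ∈ J, ¬ Disjoint (A y).1 (A y').1 → y = y' := by
    intro y hy y' hy' hnd
    obtain ⟨_, ⟨p, hp, rfl⟩, ⟨q, hq, e⟩⟩ := not_disjoint_iff.1 hnd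
    have e' : X (s y' - s y) q = p := by
      rw [← flow_neg_flow X (s y) p, ← e, ← X.map_add, neg_add_eq_sub]
    have i1 := hIκ y (hs y)
    have i2 := hIκ y' (hs y')
    have := h.transverse q hq.1 (s y' - s y)
      (by rw [abs_lt]; constructor <;> linarith [i1.1, i1.2, i2.1, i2.2]) (e' ▸ hp.1)
    exact hinj hy hy' (by linarith)
  refine ⟨F ∪ J.image A, Finset.subset_union_left, ⟨?_, ?_, ?_⟩, ?_⟩
  · intro P hP
    rcases Finset.mem_union.1 hP with hP | hP
    · exact hF.pair P hP
    · obtain ⟨y, -, rfl⟩ := Finset.mem_image.1 hP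
      exact hA y
  · intro P hP
    rcases Finset.mem_union.1 hP with hP | hP
    · exact hF.diam P hP
    · obtain ⟨y, -, rfl⟩ := Finset.mem_image.1 hP
      refine (Metric.diam_mono ((hAsub y).trans inter_subset_left) Metric.isBounded_ball).trans ?_
      linarith [Metric.diam_ball (x := c y) (half_pos hδ).le]
  · intro P hP Q hQ hPQ
    rcases Finset.mem_union.1 hP with hP | hP <;> rcases Finset.mem_union.1 hQ with hQ | hQ
    · exact hF.disjoint P hP Q hQ hPQ
    · obtain ⟨y, -, rfl⟩ := Finset.mem_image.1 hQ
      exact hFA P hP y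
    · obtain ⟨y, -, rfl⟩ := Finset.mem_image.1 hP
      exact (hFA Q hQ y).symm
    · obtain ⟨y, hy, rfl⟩ := Finset.mem_image.1 hP
      obtain ⟨y', hy', rfl⟩ := Finset.mem_image.1 hQ
      by_contra hnd
      exact hPQ (congrArg A (hAA y hy y' hy' hnd))
  · intro p hp
    obtain ⟨y, hy, hpy⟩ := mem_iUnion₂.1 (hJ hp)
    have i1 := hIκ y (hs y)
    refine ⟨-(s y), ⟨by linarith [i1.2], by linarith [i1.1]⟩, X (s y) p,
      mem_iUnion₂.2 ⟨A y, Finset.mem_union_right _ (Finset.mem_image_of_mem A hy), ?_⟩,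
      flow_neg_flow X _ _⟩
    exact ⟨p, ⟨hp, Metric.ball_subset_closedBall hpy⟩, rfl⟩

/-- One time `κ` is spent reaching a local section, another compensating for the slide of its piece.
-/
theorem exists_disjointFamily_cover (X : Flow ℝ M) (hX : FixedPointFree X) {τ δ κ : ℝ}
    (hτ : ∀ x : M, ∀ t, |t| ≤ τ → X t x = x → t = 0) (hδ : 0 < δ) (hκ : 0 < κ)
    (hκτ : 2 * κ ≤ τ) :
    ∃ F, IsDisjointFamily X τ δ F ∧
      ∀ z, ∃ P ∈ F, ∃ a ∈ P.2, ∃ t, |t| < 2 * κ ∧ X t a = z := by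
  classical
  choose S T hST hx using fun x : M => exists_local_section X hX hτ x
  obtain ⟨J, -, hJ⟩ := isCompact_univ.elim_nhds_subcover
    (fun x : M => sweep X (Ioo (-κ) κ) (T x))
    (fun x _ => mem_interior_iff_mem_nhds.1 (hx x κ hκ))
  have key : ∀ J : Finset M, ∃ F, IsDisjointFamily X τ δ F ∧
      ∀ x ∈ J, T x ⊆ sweep X (Ioo (-κ) κ) (⋃ P ∈ F, P.2) := by
    intro J
    induction J using Finset.induction with
    | empty => exact ⟨∅, ⟨by simp, by simp, by simp⟩, by simp⟩
    | insert x J _ ih =>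
      obtain ⟨F, hF, hc⟩ := ih
      obtain ⟨F', hsub, hF', hc'⟩ := hF.exists_extension hδ hκ hκτ (hST x)
      refine ⟨F', hF', fun y hy => ?_⟩
      rcases Finset.mem_insert.1 hy with rfl | hy
      · exact hc'
      · exact (hc y hy).trans (sweep_mono subset_rfl (biUnion_subset_biUnion_left hsub))
  obtain ⟨F, hF, hc⟩ := key J
  refine ⟨F, hF, fun z => ?_⟩
  obtain ⟨x, hxJ, t, ht, p, hp, rfl⟩ := mem_iUnion₂.1 (hJ (mem_univ z))
  obtain ⟨t', ht', a, ha, rfl⟩ := hc x hxJ hp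
  obtain ⟨P, hP, haP⟩ := mem_iUnion₂.1 ha
  refine ⟨P, hP, a, haP, t + t', ?_, X.map_add _ _ _⟩
  rw [abs_lt]
  constructor <;> linarith [ht.1, ht.2, ht'.1, ht'.2]

/-! ### Existence of adequate pairs with positive separation -/

theorem eventually_notMem_of_disjoint {X : Flow ℝ M} {A B : Set M} (hA : IsCompact A)
    (hB : IsClosed B) (h : Disjoint A B) : ∀ᶠ t in 𝓝[>] (0 : ℝ), ∀ p ∈ A, X t p ∉ B := by
  obtain ⟨d, hd, hdis⟩ := h.exists_thickenings hA hB
  obtain ⟨r, hr, hr'⟩ := uniform_dist_flow_self X hd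
  filter_upwards [Ioo_mem_nhdsGT hr] with t ht p hp hpB
  refine disjoint_left.1 hdis ?_ (Metric.self_subset_thickening hd B hpB)
  exact Metric.mem_thickening_iff.2 ⟨p, hp, hr' p t (by rw [abs_of_pos ht.1]; exact ht.2)⟩

/-- Transversality handles returns to the same section; disjoint compact sections are a positive
flow time apart. -/
theorem exists_no_return {X : Flow ℝ M} {k : ℕ} {S : Fin k → Set M} {τ : ℝ} (hτ : 0 < τ)
    (hS : ∀ i, IsClosed (S i)) (ht : ∀ i, IsTransverse X τ (S i))
    (hd : ∀ i j, i ≠ j → Disjoint (S i) (S j)) :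
    ∃ r > 0, ∀ p ∈ ⋃ i, S i, ∀ t ∈ Ioo 0 r, X t p ∉ ⋃ i, S i := by
  have key : ∀ᶠ t in 𝓝[>] (0 : ℝ), ∀ i j, ∀ p ∈ S i, X t p ∉ S j := by
    rw [eventually_all]; intro i
    rw [eventually_all]; intro j
    by_cases hij : i = j
    · subst hij
      filter_upwards [Ioo_mem_nhdsGT hτ] with t h0 p hp hpt
      exact h0.1.ne' (ht i p hp t (by rw [abs_of_pos h0.1]; exact h0.2) hpt)
    · exact eventually_notMem_of_disjoint (hS i).isCompact (hS j) (hd i j hij)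
  obtain ⟨r, hr, hr'⟩ := mem_nhdsGT_iff_exists_Ioo_subset.1 key
  refine ⟨r, hr, fun p hp t ht hpt => ?_⟩
  obtain ⟨i, hi⟩ := mem_iUnion.1 hp
  obtain ⟨j, hj⟩ := mem_iUnion.1 hpt
  exact hr' ht i j p hi hj

theorem exists_adequate [Nonempty M] (X : Flow ℝ M) (hX : FixedPointFree X) {τ δ ε : ℝ}
    (hτ : ∀ x : M, ∀ t, |t| ≤ τ → X t x = x → t = 0) (hδ : 0 < δ) (hε : 0 < ε) (hετ : ε ≤ τ) :
    ∃ (k : ℕ) (S T : Fin k → Set M), IsAdequate X ε δ S T ∧ 0 < separation X S ∧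
      ∀ i, IsThick X (S i) (T i) := by
  obtain ⟨F, hF, hc⟩ := exists_disjointFamily_cover X hX hτ hδ (κ := ε / 4) (by positivity)
    (by linarith)
  let e := F.equivFin
  let S : Fin F.card → Set M := fun i => (e.symm i).1.1
  let T : Fin F.card → Set M := fun i => (e.symm i).1.2
  have hp : ∀ i, IsSectionPair X τ (S i) (T i) := fun i => hF.pair _ (e.symm i).2
  have hdiam : ∀ i, Metric.diam (S i) ≤ δ := fun i => hF.diam _ (e.symm i).2
  have hsub : ∀ i, T i ⊆ S i := fun i => (hp i).thick.subset
  have hdis : ∀ i j, i ≠ j → Disjoint (S i) (S j) := fun i j hij =>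
    hF.disjoint _ (e.symm i).2 _ (e.symm j).2 fun h => hij (e.symm.injective (Subtype.ext h))
  have hc' : ∀ z, ∃ i, ∃ a ∈ T i, ∃ t, |t| < ε / 2 ∧ X t a = z := fun z => by
    obtain ⟨P, hP, a, ha, t, ht, hz⟩ := hc z
    refine ⟨e ⟨P, hP⟩, a, ?_, t, by linarith, hz⟩
    simpa [T] using ha
  -- Shifting `z` by half of `ε` turns the two-sided cover of time `ε / 2` into a one-sided cover of
  -- time `ε`.
  have hpos : (⋃ i, sweep X (Icc 0 ε) (T i)) = univ := eq_univ_of_forall fun z => by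
    obtain ⟨i, a, ha, t, ht, hz⟩ := hc' (X (-(ε / 2)) z)
    rw [abs_lt] at ht
    refine mem_iUnion.2 ⟨i, ε / 2 + t, ⟨by linarith, by linarith⟩, a, ha, ?_⟩
    rw [X.map_add, hz, flow_flow_neg]
  have hneg : (⋃ i, sweep X (Icc (-ε) 0) (T i)) = univ := eq_univ_of_forall fun z => by
    obtain ⟨i, a, ha, t, ht, hz⟩ := hc' (X (ε / 2) z)
    rw [abs_lt] at ht
    refine mem_iUnion.2 ⟨i, -(ε / 2) + t, ⟨by linarith, by linarith⟩, a, ha, ?_⟩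
    rw [X.map_add, hz, flow_neg_flow]
  refine ⟨F.card, S, T, ⟨fun i => (hp i).transverse.isCrossSection hε hετ (hp i).isClosed_left,
    fun i => ((hp i).transverse.mono (hsub i)).isCrossSection hε hετ (hp i).isClosed_right,
    hdiam, fun i => (Metric.diam_mono (hsub i) (Metric.isBounded_of_compactSpace)).trans (hdiam i),
    fun i => subset_inter ((hp i).thick.mem_interior ε hε) (hsub i), hpos, hneg,
    univ_subset_iff.1 (hpos ▸ iUnion_mono fun i => sweep_mono subset_rfl (hsub i)),
    univ_subset_iff.1 (hneg ▸ iUnion_mono fun i => sweep_mono subset_rfl (hsub i))⟩, ?_,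
    fun i => (hp i).thick⟩
  obtain ⟨r, hr, hr'⟩ := exists_no_return (X := X) (hε.trans_le hετ)
    (fun i => (hp i).isClosed_left) (fun i => (hp i).transverse) hdis
  refine separation_pos hε hr hr' fun z => ?_
  obtain ⟨i, t, ht, a, ha, rfl⟩ := mem_iUnion.1 (hneg.symm ▸ mem_univ z :
    z ∈ ⋃ i, sweep X (Icc (-ε) 0) (T i))
  exact ⟨-t, ⟨by linarith [ht.2], by linarith [ht.1]⟩, mem_iUnion.2 ⟨i, by
    rw [flow_neg_flow]; exact hsub i ha⟩⟩

end FlowSections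

namespace FlowSections

open Topology Filter

/-! ### Piecewise linear reparametrizations -/

/-- The time change is the primitive of a step function with slope `1 + r n / t n` on the `n`-th
interval. The slopes lie in `[1/2, 3/2]`, which gives monotonicity and growth. -/
theorem exists_interpolation (t r : ℕ → ℝ) {c : ℝ} (hc : 0 < c) (ht : ∀ j, c ≤ t j)
    (hr : ∀ j, |r j| ≤ t j / 2) :
    ∃ β : ℝ → ℝ, Continuous β ∧ StrictMono β ∧ β 0 = 0 ∧ Tendsto β atTop atTop ∧
      ∀ n, ∀ v ∈ Icc 0 (t n), β (∑ i ∈ Finset.range n, t i + v) =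
        ∑ i ∈ Finset.range n, (t i + r i) + v * (1 + r n / t n) := by
  set τ : ℕ → ℝ := fun n => ∑ i ∈ Finset.range n, t i with hτ
  have hτs : ∀ n, τ (n + 1) = τ n + t n := fun n => Finset.sum_range_succ _ _
  have ht0 : ∀ j, 0 < t j := fun j => hc.trans_le (ht j)
  have hmono : Monotone τ := monotone_nat_of_le_succ fun n => by
    rw [hτs]; linarith [ht0 n]
  have hlarge : ∀ n : ℕ, n * c ≤ τ n := fun n => by
    induction n with
    | zero => simp [hτ]
    | succ n ih => rw [hτs]; push_cast; linarith [ht n]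
  have hex : ∀ s : ℝ, ∃ n, s < τ (n + 1) := fun s => by
    obtain ⟨n, hn⟩ := exists_nat_gt (s / c)
    refine ⟨n, ?_⟩
    rw [div_lt_iff₀ hc] at hn
    exact (hn.trans_le (hlarge n)).trans_le (hmono n.le_succ)
  classical
  let idx : ℝ → ℕ := fun s => Nat.find (hex s)
  have hidx_mono : Monotone idx := fun a b hab => Nat.find_min' _ (hab.trans_lt (Nat.find_spec (hex b)))
  have hidx : ∀ n, ∀ s ∈ Ico (τ n) (τ (n + 1)), idx s = n := fun n s hs => by
    rw [Nat.find_eq_iff]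
    exact ⟨hs.2, fun m hm => not_lt.2 ((hmono hm).trans hs.1)⟩
  let f : ℝ → ℝ := fun s => 1 + r (idx s) / t (idx s)
  have hfm : Measurable f := by
    have h : Measurable fun n : ℕ => 1 + r n / t n := measurable_from_nat
    exact h.comp hidx_mono.measurable
  have hfb : ∀ s, |f s - 1| ≤ 1 / 2 := fun s => by
    simp only [f, add_sub_cancel_left, abs_div, abs_of_pos (ht0 (idx s))]
    rw [div_le_iff₀ (ht0 _)]
    linarith [hr (idx s)]
  have hfb' : ∀ s, 1 / 2 ≤ f s ∧ f s ≤ 3 / 2 := fun s => by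
    have := abs_le.1 (hfb s)
    constructor <;> linarith [this.1, this.2]
  have hfi : ∀ a b, IntervalIntegrable f MeasureTheory.volume a b := fun a b =>
    (intervalIntegrable_const (c := (3 / 2 : ℝ))).mono_fun' hfm.aestronglyMeasurable
      (Eventually.of_forall fun s => by
        refine abs_le.2 ?_
        constructor <;> linarith [(hfb' s).1, (hfb' s).2])
  let β : ℝ → ℝ := fun s => ∫ u in (0 : ℝ)..s, f u
  have hβ0 : β 0 = 0 := intervalIntegral.integral_same
  have hsub : ∀ a b, β b = β a + ∫ u in a..b, f u := fun a b =>
    (intervalIntegral.integral_add_adjacent_intervals (hfi 0 a) (hfi a b)).symm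
  have hgrow : ∀ a b, a ≤ b → β a + (b - a) / 2 ≤ β b := fun a b hab => by
    have h1 : ∫ _ in a..b, (1 / 2 : ℝ) ≤ ∫ u in a..b, f u :=
      intervalIntegral.integral_mono_on hab intervalIntegrable_const (hfi a b)
        fun u _ => (hfb' u).1
    rw [intervalIntegral.integral_const, smul_eq_mul] at h1
    rw [hsub a b]
    linarith
  have hpiece : ∀ n, ∀ v ∈ Icc 0 (t n), β (τ n + v) = β (τ n) + v * (1 + r n / t n) := by
    intro n v hv
    have h1 : ∫ u in (τ n)..(τ n + v), f u = ∫ _ in (τ n)..(τ n + v), (1 + r n / t n) := by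
      refine intervalIntegral.integral_congr_Ioo_of_le (by linarith [hv.1]) fun u hu => ?_
      have := hidx n u ⟨hu.1.le, by rw [hτs]; linarith [hu.2, hv.2]⟩
      simp only [f, this]
    rw [hsub (τ n), h1, intervalIntegral.integral_const, smul_eq_mul, add_sub_cancel_left]
  have hβτ : ∀ n, β (τ n) = ∑ i ∈ Finset.range n, (t i + r i) := fun n => by
    induction n with
    | zero => simpa [hτ] using hβ0
    | succ n ih =>
      rw [hτs, hpiece n (t n) ⟨(ht0 n).le, le_rfl⟩, ih, Finset.sum_range_succ]
      have := (ht0 n).ne'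
      field_simp
  refine ⟨β, intervalIntegral.continuous_primitive hfi 0, fun a b hab => ?_, hβ0, ?_,
    fun n v hv => ?_⟩
  · linarith [hgrow a b hab.le]
  · refine tendsto_atTop_mono' _ ?_ (tendsto_id.atTop_div_const two_pos)
    filter_upwards [eventually_ge_atTop 0] with s hs
    have := hgrow 0 s hs
    simpa [hβ0] using this
  · rw [← hβτ n]
    exact hpiece n v hv

/-- Two half-line reparametrizations glue to a homeomorphism of the line. -/
theorem exists_homeomorph_glue {β β' : ℝ → ℝ} (hc : Continuous β) (hm : StrictMono β)
    (h0 : β 0 = 0) (ht : Tendsto β atTop atTop) (hc' : Continuous β') (hm' : StrictMono β')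
    (h0' : β' 0 = 0) (ht' : Tendsto β' atTop atTop) :
    ∃ α : ℝ ≃ₜ ℝ, α 0 = 0 ∧ (∀ t, 0 ≤ t → α t = β t) ∧ ∀ t, 0 ≤ t → α (-t) = -β' t := by
  let f : ℝ → ℝ := fun t => if 0 ≤ t then β t else -β' (-t)
  have hfp : ∀ t, 0 ≤ t → f t = β t := fun t h => if_pos h
  have hfn : ∀ t, t ≤ 0 → f t = -β' (-t) := fun t h => by
    rcases h.lt_or_eq with h | rfl
    · exact if_neg h.not_ge
    · simp [f, h0, h0']
  have hcont : Continuous f := by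
    refine Continuous.if_le hc (by fun_prop) continuous_const continuous_id fun t ht => ?_
    simp [← ht, h0, h0']
  have hmono : StrictMono f := by
    refine StrictMonoOn.Iic_union_Ici (a := 0) ?_ ?_
    · intro a ha b hb hab
      rw [hfn a ha, hfn b hb]
      have : β' (-b) < β' (-a) := hm' (by linarith)
      linarith
    · intro a ha b hb hab
      rw [hfp a ha, hfp b hb]
      exact hm hab
  have htop : Tendsto f atTop atTop := ht.congr' (by
    filter_upwards [eventually_ge_atTop 0] with t h using (hfp t h).symm)
  have hbot : Tendsto f atBot atBot := by
    refine (tendsto_neg_atTop_atBot.comp (ht'.comp tendsto_neg_atBot_atTop)).congr' ?_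
    filter_upwards [eventually_le_atBot 0] with t h using (hfn t h).symm
  refine ⟨(hmono.orderIsoOfSurjective f (hcont.surjective htop hbot)).toHomeomorph, ?_, ?_, ?_⟩
  · simp [f, h0]
  · intro t h
    simpa using hfp t h
  · intro t h
    have := hfn (-t) (by linarith)
    simpa using this

/-! ### Return times -/

variable {M : Type*} [MetricSpace M]

/-- A closed set `C` met by every orbit segment of length `ε`, inside a closed set `D` to which
no orbit returns in positive time less than `r`. -/
structure IsReturnSystem (X : Flow ℝ M) (ε r : ℝ) (C D : Set M) : Prop where
  isClosed_left : IsClosed C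
  isClosed_right : IsClosed D
  subset : C ⊆ D
  eps_pos : 0 < ε
  r_pos : 0 < r
  no_return : ∀ p ∈ D, ∀ t ∈ Ioo 0 r, X t p ∉ D
  cover : ∀ z, ∃ s ∈ Icc 0 ε, X s z ∈ C

namespace IsReturnSystem

variable {X : Flow ℝ M} {ε r : ℝ} {C D : Set M}

theorem eq_zero_of_mem (h : IsReturnSystem X ε r C D) {p : M} (hp : p ∈ D) {t : ℝ} (ht : |t| < r)
    (hm : X t p ∈ D) : t = 0 := by
  by_contra hne
  rw [abs_lt] at ht
  rcases lt_or_gt_of_ne hne with hlt | hgt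
  · exact h.no_return _ hm (-t) ⟨by linarith, by linarith⟩ (by rwa [flow_neg_flow])
  · exact h.no_return p hp t ⟨hgt, ht.2⟩ hm

/-- No return happens before `r`, and from time `r` on the orbit meets `C` within `ε`. Hence the set
of return times is closed and its infimum is attained. -/
theorem returnTime_spec (h : IsReturnSystem X ε r C D) {p : M} (hp : p ∈ C) :
    r ≤ returnTime X C p ∧ returnTime X C p ≤ ε + r ∧ returnMap X C p ∈ C := by
  have hge : ∀ t ∈ {t : ℝ | 0 < t ∧ X t p ∈ C}, r ≤ t := fun t ht => by
    by_contra! hlt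
    exact h.no_return p (h.subset hp) t ⟨ht.1, hlt⟩ (h.subset ht.2)
  obtain ⟨s, hs, hsC⟩ := h.cover (X r p)
  rw [← X.map_add] at hsC
  have hmem : s + r ∈ {t : ℝ | 0 < t ∧ X t p ∈ C} := ⟨by linarith [hs.1, h.r_pos], hsC⟩
  have heq : {t : ℝ | 0 < t ∧ X t p ∈ C} = Ici r ∩ (fun t => X t p) ⁻¹' C := by
    ext t
    exact ⟨fun ht => ⟨hge t ht, ht.2⟩, fun ht => ⟨h.r_pos.trans_le ht.1, ht.2⟩⟩
  have hcl : IsClosed {t : ℝ | 0 < t ∧ X t p ∈ C} := by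
    rw [heq]
    exact isClosed_Ici.inter (h.isClosed_left.preimage (by fun_prop))
  have hbdd : BddBelow {t : ℝ | 0 < t ∧ X t p ∈ C} := ⟨r, hge⟩
  exact ⟨le_csInf ⟨_, hmem⟩ hge, (csInf_le hbdd hmem).trans (by linarith [hs.2]),
    (hcl.csInf_mem ⟨_, hmem⟩ hbdd).2⟩

theorem iterate_mem (h : IsReturnSystem X ε r C D) {x : M} (hx : x ∈ C) (n : ℕ) :
    (returnMap X C)^[n] x ∈ C := by
  induction n with
  | zero => exact hx
  | succ n ih =>
    rw [Function.iterate_succ_apply']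
    exact (h.returnTime_spec ih).2.2

theorem reverse (h : IsReturnSystem X ε r C D) (hcov : ∀ z, ∃ s ∈ Icc 0 ε, X (-s) z ∈ C) :
    IsReturnSystem X.reverse ε r C D :=
  { h with
    no_return := fun p hp t ht hm =>
      h.no_return _ hm t ht (by rwa [Flow.reverse_apply, flow_flow_neg])
    cover := hcov }

end IsReturnSystem

/-- The time of the `n`-th return to `C`. -/
noncomputable def cumulativeTime (X : Flow ℝ M) (C : Set M) (x : M) (n : ℕ) : ℝ :=
  ∑ i ∈ Finset.range n, returnTime X C ((returnMap X C)^[i] x)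

theorem iterate_returnMap_eq (X : Flow ℝ M) (C : Set M) (x : M) (n : ℕ) :
    (returnMap X C)^[n] x = X (cumulativeTime X C x n) x := by
  induction n with
  | zero => simp [cumulativeTime]
  | succ n ih =>
    rw [Function.iterate_succ_apply', cumulativeTime, Finset.sum_range_succ, add_comm, X.map_add]
    change _ = X _ (X (cumulativeTime X C x n) x)
    rw [← ih]
    rfl

theorem IsAdequate.exists_returnSystem {X : Flow ℝ M} {ε δ : ℝ} {k : ℕ} {S T : Fin k → Set M}
    (h : IsAdequate X ε δ S T) (hε : 0 < ε) {ρ : ℝ} (hρ : 0 < ρ) (hsep : ρ < separation X S) :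
    ∃ r, ρ < r ∧ IsReturnSystem X ε r (⋃ i, T i) (⋃ i, S i) ∧
      IsReturnSystem X.reverse ε r (⋃ i, T i) (⋃ i, S i) := by
  have hne : {r : ℝ | 0 < r ∧ ∀ x ∈ ⋃ i, S i, sweep X (Ioo 0 r) {x} ∩ (⋃ i, S i) = ∅}.Nonempty := by
    by_contra hemp
    rw [not_nonempty_iff_eq_empty] at hemp
    -- The supremum of the empty set is `0`, so a positive separation guarantees an admissible `r`.
    rw [separation, hemp, Real.sSup_empty] at hsep
    linarith
  obtain ⟨r, ⟨hr, hr'⟩, hlt⟩ := exists_lt_of_lt_csSup hne hsep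
  have hsys : IsReturnSystem X ε r (⋃ i, T i) (⋃ i, S i) :=
    { isClosed_left := isClosed_iUnion_of_finite fun i => (h.section_T i).isClosed
      isClosed_right := isClosed_iUnion_of_finite fun i => (h.section_S i).isClosed
      subset := iUnion_mono fun i => (h.subset_interior i).trans inter_subset_right
      eps_pos := hε
      r_pos := hr
      no_return := fun p hp t ht hm => by
        have := hr' p hp
        rw [← disjoint_iff_inter_eq_empty, disjoint_left] at this
        exact this ⟨t, ht, p, rfl, rfl⟩ hm
      cover := fun z => by
        obtain ⟨i, t, ht, a, ha, rfl⟩ := mem_iUnion.1 (h.cover_T_neg.symm ▸ mem_univ z :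
          z ∈ ⋃ i, sweep X (Icc (-ε) 0) (T i))
        exact ⟨-t, ⟨by linarith [ht.2], by linarith [ht.1]⟩, mem_iUnion.2 ⟨i, by
          rwa [flow_neg_flow]⟩⟩ }
  refine ⟨r, hlt, hsys, hsys.reverse fun z => ?_⟩
  obtain ⟨i, t, ht, a, ha, rfl⟩ := mem_iUnion.1 (h.cover_T_pos.symm ▸ mem_univ z :
    z ∈ ⋃ i, sweep X (Icc 0 ε) (T i))
  exact ⟨t, ht, mem_iUnion.2 ⟨i, by rwa [flow_neg_flow]⟩⟩

/-! ### Points of stable sets shadow the orbit -/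

variable [CompactSpace M]

/-- Close points of `D` related by a short flow time and a small perturbation are related by a
small time. -/
theorem IsReturnSystem.uniform_projection_time {X : Flow ℝ M} {ε r : ℝ} {C D : Set M}
    (h : IsReturnSystem X ε r C D) {ρ γ : ℝ} (hρ : ρ < r) (hγ : 0 < γ) :
    ∃ η > 0, ∀ p ∈ D, ∀ z, ∀ s, |s| ≤ ρ → dist z p < η → dist (X s z) p < η → |s| < γ := by
  have hK : IsCompact ((Icc (-ρ) ρ ∩ {s : ℝ | γ ≤ |s|}) ×ˢ D) :=
    (isCompact_Icc.inter_right (isClosed_le continuous_const continuous_abs)).prod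
      h.isClosed_right.isCompact
  obtain ⟨m, hm, hmin⟩ := hK.exists_forall_le' (a := (0 : ℝ))
    (f := fun z : ℝ × M => dist (X z.1 z.2) z.2) (by fun_prop) (by
      rintro ⟨s, p⟩ ⟨⟨hs, hs'⟩, hp⟩
      refine dist_pos.2 fun e => ?_
      have h0 := h.eq_zero_of_mem hp ((abs_le.2 hs).trans_lt hρ) (by
        change X s p = p at e
        rwa [e])
      change γ ≤ |s| at hs'
      simp only at h0
      rw [h0, abs_zero] at hs'
      linarith)
  obtain ⟨δ, hδ, hu⟩ := uniform_dist_flow X ρ (half_pos hm)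
  refine ⟨min δ (m / 2), by positivity, fun p hp z s hs hz hsz => ?_⟩
  by_contra! hge
  have h1 := hmin (s, p) ⟨⟨abs_le.1 hs, hge⟩, hp⟩
  have h2 := hu z p (hz.trans_le (min_le_left _ _)) s hs
  have h3 := hsz.trans_le (min_le_right _ _)
  have h4 := dist_triangle_left (X s p) p (X s z)
  simp only at h1
  linarith

theorem IsReturnSystem.exists_shadowing {X : Flow ℝ M} {ε r : ℝ} {k : ℕ} {S T : Fin k → Set M}
    (h : IsReturnSystem X ε r (⋃ i, T i) (⋃ i, S i)) {ρ δ : ℝ} (hρ : ρ < r) (hδ : 0 < δ) :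
    ∃ η > 0, ∀ i, ∀ x ∈ T i, ∀ y ∈ stableSet X S T ρ η i x,
      ∃ β : ℝ → ℝ, Continuous β ∧ StrictMono β ∧ β 0 = 0 ∧ Tendsto β atTop atTop ∧
        ∀ t, 0 ≤ t → dist (X (β t) y) (X t x) < δ := by
  set C := ⋃ i, T i with hC
  obtain ⟨δ₁, hδ₁, h₁⟩ := uniform_dist_flow X (ε + r) (half_pos hδ)
  obtain ⟨r₁, hr₁, h₂⟩ := uniform_dist_flow_self X (half_pos hδ)
  have hr0 := h.r_pos
  obtain ⟨η₁, hη₁, h₃⟩ := h.uniform_projection_time hρ (γ := min r₁ (r / 2)) (by positivity)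
  obtain ⟨η₂, hη₂, h₄⟩ := uniform_dist_flow X (ε + r) hη₁
  refine ⟨min δ₁ (min η₁ η₂), by positivity, fun i x hx y hy => ?_⟩
  obtain ⟨-, u, ⟨hu0, hus⟩, hud⟩ := hy
  have hxC : x ∈ C := mem_iUnion.2 ⟨i, hx⟩
  set t : ℕ → ℝ := fun j => returnTime X C ((returnMap X C)^[j] x) with ht
  have htspec : ∀ j, r ≤ t j ∧ t j ≤ ε + r := fun j =>
    ⟨(h.returnTime_spec (h.iterate_mem hxC j)).1, (h.returnTime_spec (h.iterate_mem hxC j)).2.1⟩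
  have htabs : ∀ j, ∀ v ∈ Icc 0 (t j), |v| ≤ ε + r := fun j v hv => by
    rw [abs_of_nonneg hv.1]; exact hv.2.trans (htspec j).2
  have hxsucc : ∀ j, (returnMap X C)^[j + 1] x = X (t j) ((returnMap X C)^[j] x) := fun j =>
    Function.iterate_succ_apply' _ _ _
  -- The bound `r₁` keeps the correction harmless for distances; `r / 2` is at most half a return
  -- time, as the interpolation needs.
  have hstep : ∀ j, ∃ s, |s| < min r₁ (r / 2) ∧ u (j + 1) = X s (X (t j) (u j)) := by
    intro j
    obtain ⟨l, hl, hmem, s, hs, hsu⟩ := hus j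
    refine ⟨s, h₃ ((returnMap X C)^[j + 1] x) (h.subset (h.iterate_mem hxC _)) (X (t j) (u j)) s
      hs.le ?_ ?_, hsu.symm⟩
    · rw [hxsucc, dist_comm]
      exact h₄ _ _ ((hud j).trans_le ((min_le_right _ _).trans (min_le_right _ _))) _
        (htabs j _ ⟨hr0.le.trans (htspec j).1, le_rfl⟩)
    · rw [hsu, dist_comm]
      exact (hud (j + 1)).trans_le ((min_le_right _ _).trans (min_le_left _ _))
  choose s hs hsu using hstep
  have hs1 : ∀ j, |s j| < r₁ := fun j => (hs j).trans_le (min_le_left _ _)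
  have hs2 : ∀ j, |s j| < r / 2 := fun j => (hs j).trans_le (min_le_right _ _)
  obtain ⟨β, hβc, hβm, hβ0, hβt, hβ⟩ := exists_interpolation t s hr0 (fun j => (htspec j).1)
    fun j => by linarith [hs2 j, (htspec j).1]
  have hu : ∀ n, u n = X (∑ i ∈ Finset.range n, (t i + s i)) y := fun n => by
    induction n with
    | zero => simp [hu0]
    | succ n ih =>
      rw [hsu, ih, Finset.sum_range_succ, ← X.map_add, ← X.map_add]
      congr 1
      ring
  refine ⟨β, hβc, hβm, hβ0, hβt, fun q hq => ?_⟩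
  obtain ⟨n, v, hv, rfl⟩ : ∃ n, ∃ v ∈ Icc 0 (t n), q = cumulativeTime X C x n + v := by
    have hlarge : ∀ n : ℕ, n * r ≤ cumulativeTime X C x n := fun n => by
      have := Finset.card_nsmul_le_sum (Finset.range n) t r fun j _ => (htspec j).1
      simpa [cumulativeTime] using this
    obtain ⟨N, hN⟩ := exists_nat_gt (q / r)
    rw [div_lt_iff₀ hr0] at hN
    have hex : ∃ n, q < cumulativeTime X C x n := ⟨N, hN.trans_le (hlarge N)⟩
    classical
    obtain ⟨n, hn⟩ : ∃ n, Nat.find hex = n + 1 := Nat.exists_eq_succ_of_ne_zero fun h0 => by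
      have := Nat.find_spec hex
      rw [h0] at this
      simp [cumulativeTime] at this
      linarith
    have h1 := Nat.find_spec hex
    have h2 := Nat.find_min hex (m := n) (by omega)
    rw [hn, cumulativeTime, Finset.sum_range_succ] at h1
    change q < cumulativeTime X C x n + t n at h1
    exact ⟨n, q - cumulativeTime X C x n, ⟨by linarith, by linarith⟩, by ring⟩
  have e1 : X (cumulativeTime X C x n + v) x = X v ((returnMap X C)^[n] x) := by
    rw [add_comm, X.map_add, iterate_returnMap_eq]
  -- Inside the `n`-th interval the time change is ordinary flow from `u n` plus a fraction of the
  -- correction `s n`.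
  have e2 : X (β (cumulativeTime X C x n + v)) y = X (v * (s n / t n)) (X v (u n)) := by
    rw [cumulativeTime, hβ n v hv, hu, ← X.map_add, ← X.map_add]
    congr 1
    ring
  have ht0 : 0 < t n := hr0.trans_le (htspec n).1
  have e3 : |v * (s n / t n)| < r₁ := by
    refine lt_of_le_of_lt ?_ (hs1 n)
    rw [abs_mul, abs_div, abs_of_nonneg hv.1, abs_of_pos ht0, ← mul_div_assoc,
      div_le_iff₀ ht0, mul_comm]
    exact mul_le_mul_of_nonneg_left hv.2 (abs_nonneg _)
  rw [e1, e2]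
  have e4 := h₂ (X v (u n)) _ e3
  have e5 := h₁ _ _ ((hud n).trans_le (min_le_left _ _)) v (htabs n v hv)
  rw [dist_comm] at e5
  linarith [dist_triangle (X (v * (s n / t n)) (X v (u n))) (X v (u n))
    (X v ((returnMap X C)^[n] x))]

/-! ### From expansiveness to the bound on sections -/

theorem IsNExpansive.sectionBound {X : Flow ℝ M} {N : ℕ} (hN : IsNExpansive X N) {ε : ℝ}
    (hε : 0 < ε) (δ : ℝ) : SectionBound X N ε δ := by
  intro k S T hST ρ hρ _ hsep
  obtain ⟨r, hr, hX, hX'⟩ := hST.exists_returnSystem hε (by positivity) hsep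
  -- Expansiveness is used at the scale `r` of no return, where section points on one orbit segment
  -- coincide.
  obtain ⟨d, hd, hexp⟩ := hN r hX.r_pos
  obtain ⟨η, hη, h₁⟩ := hX.exists_shadowing (ρ := ρ) (by linarith) (δ := d / 3) (by positivity)
  obtain ⟨η', hη', h₂⟩ := hX'.exists_shadowing (ρ := ρ) (by linarith) (δ := d / 3) (by positivity)
  have hmono : ∀ (Y : Flow ℝ M) i x (a b : ℝ), a ≤ b →
      stableSet Y S T ρ a i x ⊆ stableSet Y S T ρ b i x :=
    fun Y i x a b hab y ⟨hy, u, hu, hlt⟩ => ⟨hy, u, hu, fun j => (hlt j).trans_le hab⟩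
  refine ⟨min η η', lt_min hη hη', fun i x hx => ?_⟩
  set W := stableSet X S T ρ (min η η') i x ∩ unstableSet X S T ρ (min η η') i x with hW
  have hshadow : ∀ y ∈ W, ∃ α : ℝ ≃ₜ ℝ, α 0 = 0 ∧ ∀ t, dist (X (α t) y) (X t x) < d / 3 := by
    rintro y ⟨hy, hy'⟩
    obtain ⟨β, b1, b2, b3, b4, hβ⟩ := h₁ i x hx y (hmono _ _ _ _ _ (min_le_left _ _) hy)
    obtain ⟨β', b1', b2', b3', b4', hβ'⟩ := h₂ i x hx y (hmono _ _ _ _ _ (min_le_right _ _) hy')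
    obtain ⟨α, h0, hp, hn⟩ := exists_homeomorph_glue b1 b2 b3 b4 b1' b2' b3' b4'
    refine ⟨α, h0, fun t => ?_⟩
    rcases le_total 0 t with ht | ht
    · rw [hp t ht]; exact hβ t ht
    · have e1 := hn (-t) (by linarith)
      have e2 := hβ' (-t) (by linarith)
      rw [neg_neg] at e1
      rw [Flow.reverse_apply, Flow.reverse_apply, neg_neg, ← e1] at e2
      exact e2
  choose! a ha0 ha using hshadow
  by_contra! hlt
  have hle : ((N + 1 : ℕ) : ℕ∞) ≤ W.encard := by
    push_cast
    exact Order.add_one_le_of_lt hlt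
  obtain ⟨V, hVW, hV⟩ := exists_subset_encard_eq hle
  have hVfin : V.Finite := finite_of_encard_eq_coe hV
  classical
  -- Adding `x` supplies the member with the identity time change. As `A` is finite, continuity in
  -- `a` is automatic.
  set A := insert x V with hA
  have hAfin : Finite A := (hVfin.insert x).to_subtype
  let α : A → ℝ ≃ₜ ℝ := fun p => if (p : M) = x then Homeomorph.refl ℝ else a p
  have hAW : ∀ p : A, (p : M) = x ∨ (p : M) ∈ W := fun p => p.2.imp_right fun h => hVW h
  have hαrep : IsReparametrization A α := by
    refine ⟨fun p => ?_, ⟨⟨x, mem_insert x V⟩, by simp [α]⟩, fun t => continuous_of_discreteTopology⟩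
    by_cases hp : (p : M) = x
    · simp [α, hp]
    · simpa [α, hp] using ha0 p ((hAW p).resolve_left hp)
  have hclose : ∀ (p : A) t, dist (X (α p t) p) (X t x) ≤ d / 3 := fun p t => by
    by_cases hp : (p : M) = x
    · simp only [α, hp, if_true, Homeomorph.refl_apply, id, dist_self]
      positivity
    · simpa [α, hp] using (ha p ((hAW p).resolve_left hp) t).le
  obtain ⟨B, hBA, hBN, hAB⟩ := hexp A α hαrep fun t => by
    refine (Metric.diam_le_of_forall_dist_le (C := 2 * (d / 3)) (by positivity) ?_).trans_lt
      (by linarith)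
    rintro _ ⟨p, rfl⟩ _ ⟨q, rfl⟩
    have := dist_triangle_right (X (α p t) p) (X (α q t) q) (X t x)
    linarith [hclose p t, hclose q t]
  have hAS : ∀ p ∈ A, p ∈ ⋃ i, S i := fun p hp => by
    rcases hAW ⟨p, hp⟩ with h | h
    · exact hX.subset (mem_iUnion.2 ⟨i, (show p = x from h) ▸ hx⟩)
    · exact mem_iUnion.2 ⟨i, h.1.1⟩
  have hsub : A ⊆ B := fun p hp => by
    obtain ⟨t, ht, b, hb, hbp⟩ := hAB hp
    have h0 := hX.eq_zero_of_mem (hAS b (hBA hb)) (abs_lt.2 ht) (hbp ▸ hAS p hp)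
    rw [h0, X.map_zero_apply] at hbp
    exact hbp ▸ hb
  have hcard : ((N + 1 : ℕ) : ℕ∞) ≤ N := by
    rw [← hV]
    exact (encard_le_encard ((subset_insert x V).trans hsub)).trans hBN
  have := Nat.cast_le.1 hcard
  omega

end FlowSections

namespace FlowSections

open Topology Filter

variable {M : Type*} [MetricSpace M]

/-- All points of a following sequence lie on one orbit, so the sequence can be recorded by its
times `b j`; the projection times are then differences. -/
theorem mem_stableSet_of_times {X : Flow ℝ M} {k : ℕ} {S T : Fin k → Set M} {ρ η : ℝ} {i : Fin k}
    {x y z : M} {b : ℕ → ℝ} {l : ℕ → Fin k} (hy : y ∈ S i) (h0 : X (b 0) z = y)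
    (hT : ∀ j, (returnMap X (⋃ i, T i))^[j] x ∈ T (l j)) (hS : ∀ j, X (b (j + 1)) z ∈ S (l (j + 1)))
    (hb : ∀ j, |b (j + 1) - (returnTime X (⋃ i, T i) ((returnMap X (⋃ i, T i))^[j] x) + b j)| < ρ)
    (hd : ∀ j, dist ((returnMap X (⋃ i, T i))^[j] x) (X (b j) z) < η) :
    y ∈ stableSet X S T ρ η i x :=
  ⟨hy, fun j => X (b j) z, ⟨h0, fun j => ⟨l (j + 1), hT (j + 1), hS j, _, hb j, by
    rw [← X.map_add, ← X.map_add, add_assoc, sub_add_cancel]⟩⟩, hd⟩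

variable [CompactSpace M]

/-! ### Time changes of nearby orbits -/

/-- A time change keeping two orbits close stays close to the identity on bounded intervals. -/
theorem uniform_drift {X : Flow ℝ M} {τ : ℝ} (hτ : 0 < τ)
    (hper : ∀ x : M, ∀ t, |t| ≤ τ → X t x = x → t = 0) (L : ℝ) {γ : ℝ} (hγ : 0 < γ) :
    ∃ δ > 0, ∀ (p q : M) (β : ℝ → ℝ), Continuous β → β 0 = 0 →
      ∀ t ∈ Icc 0 L, (∀ s ∈ Icc 0 t, dist (X (β s) p) (X s q) < δ) → |β t - t| < γ := by
  set κ := min γ τ with hκ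
  have hκ0 : 0 < κ := lt_min hγ hτ
  obtain ⟨c, hc, hmin⟩ := (isCompact_univ (X := M)).exists_forall_le' (a := (0 : ℝ))
    (f := fun z : M => dist (X κ z) z) (by fun_prop) (fun z _ => dist_pos.2 fun e => by
      have := hper z κ (by rw [abs_of_pos hκ0]; exact min_le_right _ _) e
      linarith)
  have hmove : ∀ z w : M, ∀ s, |s| = κ → X s z = w → c ≤ dist w z := by
    rintro z _ s hs rfl
    rcases eq_or_eq_neg_of_abs_eq hs with rfl | rfl
    · exact hmin z (mem_univ z)
    · have := hmin (X (-κ) z) (mem_univ _)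
      rw [flow_flow_neg, dist_comm] at this
      exact this
  obtain ⟨δ, hδ, hu⟩ := uniform_dist_flow X L (η := c / 2) (by positivity)
  refine ⟨min δ (c / 2), by positivity, fun p q β hβ hβ0 t ht hclose => ?_⟩
  by_contra! hge
  have hcont : ContinuousOn (fun s => |β s - s|) (Icc 0 t) := by fun_prop
  -- A drift reaching `γ` passes through exactly `κ`, and flowing for time `κ` moves every point by
  -- at least `c`.
  obtain ⟨s, hs, hsκ⟩ := intermediate_value_Icc ht.1 hcont
    (show κ ∈ Icc |β 0 - 0| |β t - t| from
      ⟨by simp [hβ0, hκ0.le], (min_le_left _ _).trans hge⟩)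
  have e1 := hmove (X s p) (X (β s) p) (β s - s) hsκ (by rw [← X.map_add, sub_add_cancel])
  have e2 := (hclose s hs).trans_le (min_le_right _ _)
  have e3 : dist p q < δ := by
    have := (hclose 0 ⟨le_rfl, ht.1⟩).trans_le (min_le_left _ _)
    simpa [hβ0] using this
  have e4 := hu p q e3 s (by rw [abs_of_nonneg hs.1]; exact hs.2.trans ht.2)
  linarith [dist_triangle_right (X (β s) p) (X s p) (X s q)]

/-- Points close to a thick subset of a section reach the section in short time. -/
theorem IsThick.uniform_projection {X : Flow ℝ M} {S T : Set M} (h : IsThick X S T)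
    (hT : IsClosed T) {γ η : ℝ} (hγ : 0 < γ) (hη : 0 < η) :
    ∃ δ > 0, ∀ p ∈ T, ∀ z, dist z p < δ → ∃ r, |r| < γ ∧ X r z ∈ S ∧ dist p (X r z) < η := by
  obtain ⟨r₁, hr₁, hd⟩ := uniform_dist_flow_self X (half_pos hη)
  obtain ⟨δ, hδ, hsub⟩ := hT.isCompact.exists_thickening_subset_open isOpen_interior
    (h.mem_interior (min γ r₁) (lt_min hγ hr₁))
  refine ⟨min δ (η / 2), by positivity, fun p hp z hz => ?_⟩
  obtain ⟨t, ht, a, ha, rfl⟩ := interior_subset (hsub (Metric.mem_thickening_iff.2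
    ⟨p, hp, hz.trans_le (min_le_left _ _)⟩))
  have hta := abs_lt.2 ht
  rw [← abs_neg] at hta
  refine ⟨-t, hta.trans_le (min_le_left _ _), by rwa [flow_neg_flow], ?_⟩
  have e1 := hd (X t a) (-t) (hta.trans_le (min_le_right _ _))
  have e2 := hz.trans_le (min_le_right _ _)
  have e3 := dist_triangle (X (-t) (X t a)) (X t a) p
  rw [dist_comm p]
  linarith

theorem uniform_projection_family {X : Flow ℝ M} {k : ℕ} {S T : Fin k → Set M}
    (h : ∀ i, IsThick X (S i) (T i)) (hT : ∀ i, IsClosed (T i)) {γ η : ℝ} (hγ : 0 < γ)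
    (hη : 0 < η) :
    ∃ δ > 0, ∀ i, ∀ p ∈ T i, ∀ z, dist z p < δ →
      ∃ r, |r| < γ ∧ X r z ∈ S i ∧ dist p (X r z) < η := by
  choose δ hδ hp using fun i => (h i).uniform_projection (hT i) hγ hη
  have key : ∀ᶠ d in 𝓝[>] (0 : ℝ), ∀ i, d < δ i :=
    eventually_all.2 fun i => by
      filter_upwards [Ioo_mem_nhdsGT (hδ i)] with d hd using hd.2
  obtain ⟨d, hd, hd0⟩ := (key.and self_mem_nhdsWithin).exists
  exact ⟨d, hd0, fun i p hpT z hz => hp i p hpT z (hz.trans (hd i))⟩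

/-- A point of the section whose reparametrized orbit stays close to the orbit of `x` is in the
stable set of `x`. -/
theorem IsReturnSystem.exists_mem_stableSet {X : Flow ℝ M} {ε r : ℝ} {k : ℕ}
    {S T : Fin k → Set M} (h : IsReturnSystem X ε r (⋃ i, T i) (⋃ i, S i))
    (hthick : ∀ i, IsThick X (S i) (T i)) (hT : ∀ i, IsClosed (T i)) {τ : ℝ} (hτ : 0 < τ)
    (hper : ∀ x : M, ∀ t, |t| ≤ τ → X t x = x → t = 0) {ρ η : ℝ} (hρ : 0 < ρ) (hη : 0 < η) :
    ∃ δ > 0, ∀ i, ∀ x ∈ T i, ∀ (z : M) (β : ℝ → ℝ), Continuous β → β 0 = 0 →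
      (∀ t, 0 ≤ t → dist (X (β t) z) (X t x) < δ) →
      ∀ s, |s| < ρ / 3 → X s z ∈ S i → dist x (X s z) < η →
        X s z ∈ stableSet X S T ρ η i x := by
  obtain ⟨δ₁, hδ₁, h₁⟩ := uniform_drift hτ hper (ε + r) (γ := ρ / 3) (by positivity)
  obtain ⟨δ₂, hδ₂, h₂⟩ := uniform_projection_family hthick hT (γ := ρ / 3) (by positivity) hη
  refine ⟨min δ₁ δ₂, lt_min hδ₁ hδ₂, fun i x hx z β hβ hβ0 hclose s hs hsS hsd => ?_⟩
  set C := ⋃ i, T i with hC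
  have hxC : x ∈ C := mem_iUnion.2 ⟨i, hx⟩
  set t : ℕ → ℝ := fun j => returnTime X C ((returnMap X C)^[j] x) with ht
  have htspec : ∀ j, r ≤ t j ∧ t j ≤ ε + r := fun j =>
    ⟨(h.returnTime_spec (h.iterate_mem hxC j)).1, (h.returnTime_spec (h.iterate_mem hxC j)).2.1⟩
  have ht0 : ∀ j, 0 ≤ t j := fun j => h.r_pos.le.trans (htspec j).1
  have hcum0 : ∀ j, 0 ≤ cumulativeTime X C x j := fun j => Finset.sum_nonneg fun j _ => ht0 j
  have hcums : ∀ j, cumulativeTime X C x (j + 1) = cumulativeTime X C x j + t j := fun j =>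
    Finset.sum_range_succ _ _
  have hproj : ∀ j, ∃ l, ∃ q, (returnMap X C)^[j] x ∈ T l ∧ |q| < ρ / 3 ∧
      X (q + β (cumulativeTime X C x j)) z ∈ S l ∧
      dist ((returnMap X C)^[j] x) (X (q + β (cumulativeTime X C x j)) z) < η ∧
      (j = 0 → q = s) := by
    intro j
    -- At `j = 0` the given point `X s z` must be kept; only later returns may choose their
    -- projection.
    rcases j.eq_zero_or_pos with rfl | hj
    · exact ⟨i, s, hx, hs, by simpa [cumulativeTime, hβ0] using hsS,
        by simpa [cumulativeTime, hβ0] using hsd, fun _ => rfl⟩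
    · obtain ⟨l, hl⟩ := mem_iUnion.1 (h.iterate_mem hxC j)
      have hd := (hclose _ (hcum0 j)).trans_le (min_le_right _ _)
      rw [← iterate_returnMap_eq] at hd
      obtain ⟨q, hq, hqS, hqd⟩ := h₂ l _ hl _ hd
      rw [← X.map_add] at hqS hqd
      exact ⟨l, q, hl, hq, hqS, hqd, fun e => absurd e hj.ne'⟩
  choose l q hl hq hqS hqd hq0 using hproj
  refine mem_stableSet_of_times (b := fun j => q j + β (cumulativeTime X C x j)) (l := l) hsS
    (by simp [hq0 0 rfl, cumulativeTime, hβ0]) hl (fun j => hqS (j + 1)) (fun j => ?_) hqd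
  -- The time change is restarted at the `j`-th return, so drift does not accumulate. One drift and
  -- two projection times, each below `ρ / 3`, add up to less than `ρ`.
  have hdrift := h₁ (X (β (cumulativeTime X C x j)) z) ((returnMap X C)^[j] x)
    (fun v => β (cumulativeTime X C x j + v) - β (cumulativeTime X C x j)) (by fun_prop) (by simp)
    (t j) ⟨ht0 j, (htspec j).2⟩ (fun v hv => by
      rw [iterate_returnMap_eq, ← X.map_add, ← X.map_add, sub_add_cancel, add_comm v]
      exact (hclose _ (add_nonneg (hcum0 j) hv.1)).trans_le (min_le_left _ _))
  simp only [hcums]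
  change |_ - (t j + _)| < ρ
  have e1 := abs_lt.1 (hq j)
  have e2 := abs_lt.1 (hq (j + 1))
  have e3 := abs_lt.1 hdrift
  rw [abs_lt]
  constructor <;> linarith [e1.1, e1.2, e2.1, e2.2, e3.1, e3.2]

/-! ### From the bound on sections to expansiveness -/

theorem SectionBound.isNExpansive {X : Flow ℝ M} (hX : FixedPointFree X) {τ : ℝ} (hτ : 0 < τ)
    (hper : ∀ x : M, ∀ t, |t| ≤ τ → X t x = x → t = 0) {N : ℕ} {ε δ : ℝ} (hε : 0 < ε)
    (hετ : ε ≤ τ) (hδ : 0 < δ) (hN : SectionBound X N ε δ) : IsNExpansive X N := by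
  intro e he
  rcases isEmpty_or_nonempty M with hM | hM
  · exact ⟨1, one_pos, fun A α hα => by
      obtain ⟨a, -⟩ := hα.exists_id
      exact (hM.false a.1).elim⟩
  obtain ⟨k, S, T, hST, hsep, hthick⟩ := exists_adequate X hX hper hδ hε hετ
  set ρ := min (ε / 6) (separation X S / 3) with hρdef
  have hρ : 0 < ρ := by positivity
  have hρ1 : ρ ≤ ε / 6 := min_le_left _ _
  have hρ2 : ρ ≤ separation X S / 3 := min_le_right _ _
  obtain ⟨η, hη, hbound⟩ := hN k S T hST ρ hρ (by linarith) (by linarith)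
  obtain ⟨r, -, hsys, hsys'⟩ := hST.exists_returnSystem hε hρ (by linarith)
  have hclT : ∀ i, IsClosed (T i) := fun i => (hST.section_T i).isClosed
  have hthick' : ∀ i, IsThick X.reverse (S i) (T i) := fun i =>
    ⟨(hthick i).subset, fun γ hγ => ((hthick i).mem_interior γ hγ).trans (interior_mono (by
      rintro _ ⟨t, ht, a, ha, rfl⟩
      exact ⟨-t, ⟨by linarith [ht.2], by linarith [ht.1]⟩, a, ha, by
        rw [Flow.reverse_apply, neg_neg]⟩))⟩
  have hper' : ∀ x : M, ∀ t, |t| ≤ τ → X.reverse t x = x → t = 0 := fun x t ht hx =>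
    neg_eq_zero.1 (hper x (-t) (by rwa [abs_neg]) hx)
  obtain ⟨d₁, hd₁, h₁⟩ := hsys.exists_mem_stableSet hthick hclT hτ hper hρ hη
  obtain ⟨d₂, hd₂, h₂⟩ := hsys'.exists_mem_stableSet hthick' hclT hτ hper' hρ hη
  set γ := min (ρ / 3) (e / 4) with hγdef
  have hγ : 0 < γ := by positivity
  obtain ⟨d₃, hd₃, h₃⟩ := uniform_projection_family hthick hclT hγ hη
  obtain ⟨d₄, hd₄, h₄⟩ := uniform_drift hτ hper ε hγ
  refine ⟨min (min d₁ d₂) (min d₃ d₄), by positivity, fun A α hα hdiam => ?_⟩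
  obtain ⟨a₀, ha₀⟩ := hα.exists_id
  have hclose : ∀ (a : A) t, dist (X (α a t) a) (X t a₀) < min (min d₁ d₂) (min d₃ d₄) :=
    fun a t => by
      have h0 : X t a₀ ∈ reparamImage X A α t := ⟨a₀, by simp [ha₀]⟩
      exact (Metric.dist_le_diam_of_mem Metric.isBounded_of_compactSpace (mem_range_self a)
        h0).trans_lt (hdiam t)
  obtain ⟨s, hs, hsT⟩ := hsys.cover (a₀ : M)
  obtain ⟨i, hi⟩ := mem_iUnion.1 hsT
  have hproj : ∀ a : A, ∃ q, |q| < γ ∧ X (q + α a s) a ∈ S i ∧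
      dist (X s a₀) (X (q + α a s) a) < η := fun a => by
    obtain ⟨q, hq, hqS, hqd⟩ := h₃ i _ hi _
      ((hclose a s).trans_le ((min_le_right _ _).trans (min_le_left _ _)))
    rw [← X.map_add] at hqS hqd
    exact ⟨q, hq, hqS, hqd⟩
  choose q hq hqS hqd using hproj
  have hdrift : ∀ a : A, |α a s - s| < γ := fun a =>
    h₄ a a₀ (α a) (α a).continuous (hα.map_zero a) s hs fun v _ =>
      (hclose a v).trans_le ((min_le_right _ _).trans (min_le_right _ _))
  let y : A → M := fun a => X (q a + α a s) a
  have hmem : ∀ a, y a ∈ stableSet X S T ρ η i (X s a₀) ∩ unstableSet X S T ρ η i (X s a₀) := by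
    intro a
    have hqρ : |q a| < ρ / 3 := (hq a).trans_le (min_le_left _ _)
    have hy : y a = X (q a) (X (α a s) a) := X.map_add _ _ _
    have hy' : y a = X.reverse (-q a) (X (α a s) a) := by rw [hy, Flow.reverse_apply, neg_neg]
    -- The time changes are recentred at `s`, where the reference orbit meets `T i`.
    have hcl : ∀ t, dist (X (α a (t + s) - α a s) (X (α a s) a)) (X t (X s a₀)) < min d₁ d₂ :=
      fun t => by
        rw [← X.map_add, ← X.map_add, sub_add_cancel]
        exact (hclose a _).trans_le (min_le_left _ _)
    have hc := (α a).continuous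
    constructor
    · rw [hy]
      refine h₁ i _ hi _ (fun t => α a (t + s) - α a s) (by fun_prop) (by simp)
        (fun t _ => (hcl t).trans_le (min_le_left _ _)) _ hqρ ?_ ?_
      · rw [← hy]; exact hqS a
      · rw [← hy]; exact hqd a
    · rw [hy']
      refine h₂ i _ hi _ (fun t => -(α a (-t + s) - α a s)) (by fun_prop) (by simp)
        (fun t _ => ?_) _ (by rwa [abs_neg]) ?_ ?_
      · rw [Flow.reverse_apply, Flow.reverse_apply, neg_neg]
        exact (hcl (-t)).trans_le (min_le_right _ _)
      · rw [← hy']; exact hqS a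
      · rw [← hy']; exact hqd a
  have hcard : (range y).encard ≤ N :=
    (encard_le_encard (range_subset_iff.2 hmem)).trans (hbound i _ hi)
  -- `B` takes one point of `A` for each landing point.
  choose g hg using fun w : range y => w.2
  refine ⟨range fun w => (g w : M), by rintro _ ⟨w, rfl⟩; exact (g w).2, ?_, fun a ha => ?_⟩
  · rw [← image_univ]
    refine (encard_image_le _ _).trans ?_
    rwa [encard_univ, ← Set.encard]
  · have hyy : y (g ⟨y ⟨a, ha⟩, mem_range_self _⟩) = y ⟨a, ha⟩ := hg ⟨y ⟨a, ha⟩, mem_range_self _⟩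
    set b := g ⟨y ⟨a, ha⟩, mem_range_self _⟩ with hb
    have hγ' : γ ≤ e / 4 := min_le_right _ _
    have i1 := abs_lt.1 (hq ⟨a, ha⟩)
    have i2 := abs_lt.1 (hq b)
    have i3 := abs_lt.1 (hdrift ⟨a, ha⟩)
    have i4 := abs_lt.1 (hdrift b)
    refine ⟨-(q ⟨a, ha⟩ + α ⟨a, ha⟩ s) + (q b + α b s), ?_, b, ⟨_, rfl⟩, ?_⟩
    -- Two projection times and two drifts, each below `γ ≤ e / 4`.
    · constructor <;> linarith [i1.1, i1.2, i2.1, i2.2, i3.1, i3.2, i4.1, i4.2]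
    · rw [X.map_add]
      change X _ (y b) = a
      rw [hyy]
      exact flow_neg_flow X _ a

end FlowSections

theorem theoremC {M : Type*} [MetricSpace M] [CompactSpace M] (X : Flow ℝ M)
    (hX : FlowSections.FixedPointFree X) :
    (∀ N : ℕ, 0 < N → ∀ ε : ℝ, 0 < ε → ∀ δ : ℝ, 0 < δ →
      FlowSections.IsNExpansive X N → FlowSections.SectionBound X N ε δ) ∧
    ∃ ε₁ : ℝ, 0 < ε₁ ∧ ∀ N : ℕ, 0 < N → ∀ ε : ℝ, 0 < ε → ε ≤ ε₁ → ∀ δ : ℝ, 0 < δ →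
      (FlowSections.IsNExpansive X N ↔ FlowSections.SectionBound X N ε δ) := by
  refine ⟨fun N _ ε hε δ _ h => h.sectionBound hε δ, ?_⟩
  obtain ⟨τ, hτ, hper⟩ := FlowSections.exists_min_period X hX
  -- Halving `τ` turns the bound on periods for `|t| < τ` into one for closed intervals.
  exact ⟨τ / 2, half_pos hτ, fun N _ ε hε hετ δ hδ => ⟨fun h => h.sectionBound hε δ, fun h =>
    h.isNExpansive hX (half_pos hτ) (fun x t ht => hper x t (by linarith)) hε hετ hδ⟩⟩
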